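/- Let $\mathbf{Cat}$ be the category of small categories and let $\mathbf{DblCat}$ be the category of small double categories, that is, of category objects $\mathbb{D}=(\mathbb{D}_0,\mathbb{D}_1,s,t,u,m)$ in $\mathbf{Cat}$ and internal functors; $\mathbb{D}_0$ has the objects and vertical morphisms of $\mathbb{D}$, and $\mathbb{D}_1$ the horizontal morphisms and squares under vertical composition. The vertical nerve $N_v\colon\mathbf{DblCat}\to\mathbf{Cat}^{\Delta^{op}}$ sends $\mathbb{D}$ to the simplicial category whose $n$-th category $(N_v\mathbb{D})_n$ has as objects the functors $[n]\to\mathbb{D}_0$ and as morphisms the functors $[n]\to\mathbb{D}_1$, composed horizontally. Let $\tau$ be the Grothendieck topology on $\mathbf{Cat}$ with basis the families consisting of a single functor that is surjective on $k$-simplices of nerves for all $k\ge 0$. A functor is $\tau$-epi if the Yoneda embedding followed by $\tau$-sheafification sends it to an epimorphism. For a double category $\mathbb{B}$ let $\mathsf{iso}(\mathbb{B})_1\subseteq\mathbb{B}_1$ be the subcategory of horizontally invertible horizontal morphisms and horizontally invertible squares, and for a double functor $F\colon\mathbb{A}\to\mathbb{B}$ let $(\mathbb{P}_F)_0=\mathbb{A}_0\times_{\mathbb{B}_0}\mathsf{iso}(\mathbb{B})_1$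 be the pullback of $F_0$ and $t$. Then $F$ is a $\tau$-equivalence if $\mathbb{A}_1$ is the pullback of $(s,t)\colon\mathbb{B}_1\to\mathbb{B}_0\times\mathbb{B}_0$ along $F_0\times F_0$ (via $F_1$ and $(s,t)$) and $s\colon(\mathbb{P}_F)_0\to\mathsf{iso}(\mathbb{B})_1\to\mathbb{B}_0$ is $\tau$-epi; $F$ is a $\tau$-fibration if $(t,\mathsf{iso}(F)_1)\colon\mathsf{iso}(\mathbb{A})_1\to(\mathbb{P}_F)_0$ is $\tau$-epi; and $F$ is a $\tau$-cofibration if it has the left lifting property with respect to all $\tau$-fibrations that are $\tau$-equivalences. Then: 1. The $\tau$-equivalences, $\tau$-fibrations and $\tau$-cofibrations are the weak equivalences, fibrations and cofibrations of a model structure on $\mathbf{DblCat}$. 2. $N_v$ has a left adjoint $c_v$. The diagram categorical model structure on $\mathbf{Cat}^{\Delta^{op}}$, whose weak equivalences are the levelwise equivalences of categories and whose fibrations are the levelwise isofibrations, exists, and it transfers across $c_v\dashv N_v$: there is a model structure on $\mathbf{DblCat}$ in which $F$ is a weak equivalence (respectively fibration) if and only if $N_vF$ is one. If a class $I$ (respectively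 $J$) of morphisms of $\mathbf{Cat}^{\Delta^{op}}$ detects acyclic fibrations (respectively fibrations) by the right lifting property, then so does $c_v(I)$ (respectively $c_v(J)$) in $\mathbf{DblCat}$. 3. The two model structures on $\mathbf{DblCat}$ in 1 and 2 coincide: they have the same weak equivalences, fibrations and cofibrations. In particular, $F$ is a $\tau$-equivalence (respectively a $\tau$-fibration) if and only if $(N_vF)_n$ is an equivalence of categories (respectively an isofibration) for every $n\ge 0$. -/

import Mathlib

open CategoryTheory Limits Opposite HomotopicalAlgebra Simplicial

universe v u

noncomputable section

section Internal

attribute [local simp] pullback.lift_fst pullback.lift_fst_assoc pullback.lift_snd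
  pullback.lift_snd_assoc prod.lift_fst prod.lift_fst_assoc prod.lift_snd prod.lift_snd_assoc
  equalizer.lift_ι equalizer.lift_ι_assoc

/-! ### Internal categories -/

/-- A category object in `C`: an object of objects `A₀`, an object of morphisms `A₁`, source,
target and unit morphisms, and a composition `m : A₁ ×_{A₀} A₁ ⟶ A₁` defined on the pullback of
the target along the source. Associativity is expressed on generalized elements, which by the
Yoneda lemma is the usual identity of morphisms `A₁ ×_{A₀} A₁ ×_{A₀} A₁ ⟶ A₁`. -/
structure InternalCategory (C : Type u) [Category.{v} C] [HasFiniteLimits C] where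
  A₀ : C
  A₁ : C
  s : A₁ ⟶ A₀
  t : A₁ ⟶ A₀
  e : A₀ ⟶ A₁
  m : pullback t s ⟶ A₁
  e_s : e ≫ s = 𝟙 A₀
  e_t : e ≫ t = 𝟙 A₀
  m_s : m ≫ s = pullback.fst t s ≫ s
  m_t : m ≫ t = pullback.snd t s ≫ t
  e_m : pullback.lift (s ≫ e) (𝟙 A₁) (by simp [e_t]) ≫ m = 𝟙 A₁
  m_e : pullback.lift (𝟙 A₁) (t ≫ e) (by simp [e_s]) ≫ m = 𝟙 A₁
  assoc : ∀ {X : C} (f g h : X ⟶ A₁) (w₁ : f ≫ t = g ≫ s) (w₂ : g ≫ t = h ≫ s),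
    pullback.lift (pullback.lift f g w₁ ≫ m) h (by simp [m_t, w₂]) ≫ m =
      pullback.lift f (pullback.lift g h w₂ ≫ m) (by simp [m_s, w₁]) ≫ m

namespace InternalCategory

variable {C : Type u} [Category.{v} C] [HasFiniteLimits C]

/-- An internal functor. -/
@[ext]
structure Hom (A B : InternalCategory C) where
  F₀ : A.A₀ ⟶ B.A₀
  F₁ : A.A₁ ⟶ B.A₁
  map_s : F₁ ≫ B.s = A.s ≫ F₀
  map_t : F₁ ≫ B.t = A.t ≫ F₀
  map_e : A.e ≫ F₁ = F₀ ≫ B.e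
  map_m : A.m ≫ F₁ =
    pullback.lift (pullback.fst A.t A.s ≫ F₁) (pullback.snd A.t A.s ≫ F₁)
      (by simp [map_s, map_t, pullback.condition_assoc]) ≫ B.m

/-- The composite of two composable generalized morphisms, in diagrammatic order. -/
def comp (A : InternalCategory C) {X : C} (f g : X ⟶ A.A₁) (h : f ≫ A.t = g ≫ A.s) :
    X ⟶ A.A₁ :=
  pullback.lift f g h ≫ A.m

section comp

variable (A : InternalCategory C) {X Y : C}

lemma comp_congr {f g f' g' : X ⟶ A.A₁} (hf : f = f') (hg : g = g') (h : f ≫ A.t = g ≫ A.s) :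
    A.comp f g h = A.comp f' g' (by rw [← hf, ← hg, h]) := by
  subst hf hg; rfl

lemma comp_s (f g : X ⟶ A.A₁) (h : f ≫ A.t = g ≫ A.s) : A.comp f g h ≫ A.s = f ≫ A.s := by
  simp [comp, A.m_s]

lemma comp_t (f g : X ⟶ A.A₁) (h : f ≫ A.t = g ≫ A.s) : A.comp f g h ≫ A.t = g ≫ A.t := by
  simp [comp, A.m_t]

lemma precomp_comp (x : Y ⟶ X) (f g : X ⟶ A.A₁) (h : f ≫ A.t = g ≫ A.s) :
    x ≫ A.comp f g h = A.comp (x ≫ f) (x ≫ g) (by simp [h]) := by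
  simp only [comp, ← Category.assoc]
  congr 1
  ext <;> simp

lemma e_comp (f : X ⟶ A.A₁) :
    A.comp (f ≫ A.s ≫ A.e) f (by simp [A.e_t]) = f := by
  have h := A.precomp_comp f (A.s ≫ A.e) (𝟙 _) (by simp [A.e_t])
  rw [comp, A.e_m] at h
  simpa using h.symm

lemma comp_e (f : X ⟶ A.A₁) :
    A.comp f (f ≫ A.t ≫ A.e) (by simp [A.e_s]) = f := by
  have h := A.precomp_comp f (𝟙 _) (A.t ≫ A.e) (by simp [A.e_s])
  rw [comp, A.m_e] at h
  simpa using h.symm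

lemma comp_assoc (f g h : X ⟶ A.A₁) (w₁ : f ≫ A.t = g ≫ A.s) (w₂ : g ≫ A.t = h ≫ A.s) :
    A.comp (A.comp f g w₁) h (by rw [comp_t, w₂]) =
      A.comp f (A.comp g h w₂) (by rw [comp_s, w₁]) :=
  A.assoc f g h w₁ w₂

lemma Hom.comp_F₁ {A B : InternalCategory C} (F : Hom A B) (f g : X ⟶ A.A₁)
    (h : f ≫ A.t = g ≫ A.s) :
    A.comp f g h ≫ F.F₁ = B.comp (f ≫ F.F₁) (g ≫ F.F₁)
      (by simp only [Category.assoc, F.map_s, F.map_t, reassoc_of% h]) := by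
  simp only [comp, Category.assoc, F.map_m]
  simp only [← Category.assoc]
  congr 1
  ext <;> simp

end comp

instance : Category (InternalCategory C) where
  Hom := Hom
  id A :=
    { F₀ := 𝟙 _
      F₁ := 𝟙 _
      map_s := by simp
      map_t := by simp
      map_e := by simp
      map_m := by
        have : pullback.lift (pullback.fst A.t A.s) (pullback.snd A.t A.s) pullback.condition =
          𝟙 _ := by ext <;> simp
        simp [this] }
  comp {A B D} F G :=
    { F₀ := F.F₀ ≫ G.F₀
      F₁ := F.F₁ ≫ G.F₁
      map_s := by rw [Category.assoc, G.map_s, reassoc_of% F.map_s]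
      map_t := by rw [Category.assoc, G.map_t, reassoc_of% F.map_t]
      map_e := by rw [reassoc_of% F.map_e, Category.assoc, G.map_e]
      map_m := by
        rw [reassoc_of% F.map_m]
        have := G.comp_F₁ (pullback.fst A.t A.s ≫ F.F₁) (pullback.snd A.t A.s ≫ F.F₁)
          (by simp [F.map_s, F.map_t, pullback.condition_assoc])
        simpa [comp] using this }
  id_comp F := by apply Hom.ext <;> simp
  comp_id F := by apply Hom.ext <;> simp
  assoc F G H := by apply Hom.ext <;> simp

@[ext]
lemma hom_ext {A B : InternalCategory C} {F G : A ⟶ B} (h₀ : F.F₀ = G.F₀) (h₁ : F.F₁ = G.F₁) :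
    F = G :=
  Hom.ext h₀ h₁

@[simp] lemma id_F₀ (A : InternalCategory C) : (𝟙 A : A ⟶ A).F₀ = 𝟙 _ := rfl
@[simp] lemma id_F₁ (A : InternalCategory C) : (𝟙 A : A ⟶ A).F₁ = 𝟙 _ := rfl
@[simp] lemma comp_F₀ {A B D : InternalCategory C} (F : A ⟶ B) (G : B ⟶ D) :
    (F ≫ G).F₀ = F.F₀ ≫ G.F₀ := rfl
@[simp] lemma comp_F₁ {A B D : InternalCategory C} (F : A ⟶ B) (G : B ⟶ D) :
    (F ≫ G).F₁ = F.F₁ ≫ G.F₁ := rfl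

/-! ### The category of `X`-points of an internal category -/

/-- The objects of the category of `X`-points: the morphisms `X ⟶ A₀`. -/
@[ext]
structure Points (A : InternalCategory C) (X : C) where
  pt : X ⟶ A.A₀

/-- The ordinary category with objects the morphisms `X ⟶ A₀`, morphisms the morphisms
`X ⟶ A₁`, and composition induced by that of `A`. -/
instance (A : InternalCategory C) (X : C) : Category (Points A X) where
  Hom a b := {f : X ⟶ A.A₁ // f ≫ A.s = a.pt ∧ f ≫ A.t = b.pt}
  id a := ⟨a.pt ≫ A.e, by simp [A.e_s], by simp [A.e_t]⟩
  comp f g := ⟨A.comp f.1 g.1 (by rw [f.2.2, g.2.1]), by rw [comp_s, f.2.1],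
    by rw [comp_t, g.2.2]⟩
  id_comp f := Subtype.ext ((A.comp_congr (by simp [reassoc_of% f.2.1]) rfl _).trans
    (A.e_comp f.1))
  comp_id f := Subtype.ext ((A.comp_congr rfl (by simp [reassoc_of% f.2.2]) _).trans
    (A.comp_e f.1))
  assoc f g h := Subtype.ext (A.comp_assoc f.1 g.1 h.1 _ _)

namespace Points

variable {A : InternalCategory C} {X : C}

lemma hom_ext {a b : Points A X} {f g : a ⟶ b} (h : f.1 = g.1) : f = g := Subtype.ext h

lemma id_val (a : Points A X) : (𝟙 a : a ⟶ a).1 = a.pt ≫ A.e := rfl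

lemma comp_val {a b c : Points A X} (f : a ⟶ b) (g : b ⟶ c) :
    (f ≫ g).1 = A.comp f.1 g.1 (by rw [f.2.2, g.2.1]) := rfl

lemma eqToHom_conj_val {a b a' b' : Points A X} (h : a = a') (f : a' ⟶ b') (h' : b' = b) :
    (eqToHom h ≫ f ≫ eqToHom h').1 = f.1 := by
  subst h h'; simp

lemma functor_ext {D : Type*} [Category* D] {F G : D ⥤ Points A X}
    (h₀ : ∀ d, (F.obj d).pt = (G.obj d).pt)
    (h₁ : ∀ {d d' : D} (f : d ⟶ d'), (F.map f).1 = (G.map f).1) : F = G :=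
  CategoryTheory.Functor.ext (fun d ↦ Points.ext (h₀ d)) fun _ _ f ↦
    hom_ext ((h₁ f).trans (eqToHom_conj_val _ _ _).symm)

end Points

/-- Restriction of points along `x : Y ⟶ X`. -/
def Points.precomp (A : InternalCategory C) {X Y : C} (x : Y ⟶ X) : Points A X ⥤ Points A Y where
  obj a := ⟨x ≫ a.pt⟩
  map f := ⟨x ≫ f.1, by rw [Category.assoc, f.2.1], by rw [Category.assoc, f.2.2]⟩
  map_id a := Points.hom_ext (Category.assoc _ _ _).symm
  map_comp f g := Points.hom_ext (A.precomp_comp x f.1 g.1 _)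

/-- The action of an internal functor on points. -/
def Points.postcomp {A B : InternalCategory C} (F : A ⟶ B) (X : C) : Points A X ⥤ Points B X where
  obj a := ⟨a.pt ≫ F.F₀⟩
  map f := ⟨f.1 ≫ F.F₁, by rw [Category.assoc, F.map_s, reassoc_of% f.2.1],
    by rw [Category.assoc, F.map_t, reassoc_of% f.2.2]⟩
  map_id a := Points.hom_ext (by simp [Points.id_val, F.map_e])
  map_comp f g := Points.hom_ext (F.comp_F₁ f.1 g.1 _)

/-- The functor sending `A` to the presheaf of categories `X ↦ Points A X`. -/
def pointsFunctor : InternalCategory C ⥤ Cᵒᵖ ⥤ Cat.{v, v} where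
  obj A :=
    { obj X := Cat.of (Points A X.unop)
      map x := (Points.precomp A x.unop).toCatHom
      map_id _ := Cat.ext (Points.functor_ext (fun _ ↦ Category.id_comp _)
        fun _ ↦ Category.id_comp _)
      map_comp _ _ := Cat.ext (Points.functor_ext (fun _ ↦ Category.assoc _ _ _)
        fun _ ↦ Category.assoc _ _ _) }
  map F :=
    { app X := (Points.postcomp F X.unop).toCatHom
      naturality _ _ _ := Cat.ext (Points.functor_ext (fun _ ↦ Category.assoc _ _ _)
        fun _ ↦ Category.assoc _ _ _) }
  map_id _ := NatTrans.ext (funext fun _ ↦ Cat.ext (Points.functor_ext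
    (fun _ ↦ Category.comp_id _) fun _ ↦ Category.comp_id _))
  map_comp _ _ := NatTrans.ext (funext fun _ ↦ Cat.ext (Points.functor_ext
    (fun _ ↦ (Category.assoc _ _ _).symm) fun _ ↦ (Category.assoc _ _ _).symm))

/-! ### The object of isomorphisms and the mapping path object -/

/-- The object of pairs `(f, g)` of internal morphisms with `s f = t g` and `t f = s g`. -/
abbrev oppPairs (B : InternalCategory C) : C :=
  pullback (prod.lift B.s B.t) (prod.lift B.t B.s)

lemma oppPairs_s (B : InternalCategory C) :
    pullback.fst (prod.lift B.s B.t) (prod.lift B.t B.s) ≫ B.s =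
      pullback.snd (prod.lift B.s B.t) (prod.lift B.t B.s) ≫ B.t := by
  simpa using
    (pullback.condition (f := prod.lift B.s B.t) (g := prod.lift B.t B.s)) =≫ prod.fst

lemma oppPairs_t (B : InternalCategory C) :
    pullback.fst (prod.lift B.s B.t) (prod.lift B.t B.s) ≫ B.t =
      pullback.snd (prod.lift B.s B.t) (prod.lift B.t B.s) ≫ B.s := by
  simpa using
    (pullback.condition (f := prod.lift B.s B.t) (g := prod.lift B.t B.s)) =≫ prod.snd

/-- The two composites `(f g, g f)` of a pair of opposite internal morphisms. -/
def oppPairsComp (B : InternalCategory C) : B.oppPairs ⟶ B.A₁ ⨯ B.A₁ :=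
  prod.lift (B.comp (pullback.fst _ _) (pullback.snd _ _) B.oppPairs_t)
    (B.comp (pullback.snd _ _) (pullback.fst _ _) B.oppPairs_s.symm)

/-- The two identities `(1_{s f}, 1_{t f})` attached to a pair of opposite internal morphisms. -/
def oppPairsUnit (B : InternalCategory C) : B.oppPairs ⟶ B.A₁ ⨯ B.A₁ :=
  prod.lift (pullback.fst _ _ ≫ B.s ≫ B.e) (pullback.fst _ _ ≫ B.t ≫ B.e)

@[simp]
lemma oppPairsComp_fst (B : InternalCategory C) : B.oppPairsComp ≫ prod.fst =
    B.comp (pullback.fst _ _) (pullback.snd _ _) B.oppPairs_t := prod.lift_fst _ _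

@[simp]
lemma oppPairsComp_snd (B : InternalCategory C) : B.oppPairsComp ≫ prod.snd =
    B.comp (pullback.snd _ _) (pullback.fst _ _) B.oppPairs_s.symm := prod.lift_snd _ _

@[simp]
lemma oppPairsUnit_fst (B : InternalCategory C) :
    B.oppPairsUnit ≫ prod.fst = pullback.fst _ _ ≫ B.s ≫ B.e := prod.lift_fst _ _

@[simp]
lemma oppPairsUnit_snd (B : InternalCategory C) :
    B.oppPairsUnit ≫ prod.snd = pullback.fst _ _ ≫ B.t ≫ B.e := prod.lift_snd _ _

/-- The object `iso(B)₁` of invertible internal morphisms: an invertible morphism is given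
together with its inverse, which it determines. For `C = Cat` this is the category of horizontally
invertible horizontal morphisms and horizontally invertible squares, under vertical
composition. -/
abbrev iso₁ (B : InternalCategory C) : C :=
  equalizer B.oppPairsComp B.oppPairsUnit

/-- The inclusion `iso(B)₁ ⟶ B₁`. -/
def isoHom (B : InternalCategory C) : B.iso₁ ⟶ B.A₁ :=
  equalizer.ι B.oppPairsComp B.oppPairsUnit ≫ pullback.fst _ _

/-- The inverse `iso(B)₁ ⟶ B₁`. -/
def isoInv (B : InternalCategory C) : B.iso₁ ⟶ B.A₁ :=
  equalizer.ι B.oppPairsComp B.oppPairsUnit ≫ pullback.snd _ _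

lemma isoInv_t (B : InternalCategory C) : B.isoInv ≫ B.t = B.isoHom ≫ B.s := by
  rw [isoInv, isoHom, Category.assoc, Category.assoc, B.oppPairs_s]

lemma isoInv_s (B : InternalCategory C) : B.isoInv ≫ B.s = B.isoHom ≫ B.t := by
  rw [isoInv, isoHom, Category.assoc, Category.assoc, B.oppPairs_t]

lemma isoHom_comp_isoInv (B : InternalCategory C) :
    B.comp B.isoHom B.isoInv B.isoInv_s.symm = B.isoHom ≫ B.s ≫ B.e := by
  have h := equalizer.condition B.oppPairsComp B.oppPairsUnit =≫ prod.fst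
  rw [Category.assoc, Category.assoc] at h
  rw [oppPairsComp_fst, oppPairsUnit_fst, precomp_comp] at h
  exact h.trans (Category.assoc _ _ _).symm

lemma isoInv_comp_isoHom (B : InternalCategory C) :
    B.comp B.isoInv B.isoHom B.isoInv_t = B.isoHom ≫ B.t ≫ B.e := by
  have h := equalizer.condition B.oppPairsComp B.oppPairsUnit =≫ prod.snd
  rw [Category.assoc, Category.assoc] at h
  rw [oppPairsComp_snd, oppPairsUnit_snd, precomp_comp] at h
  exact h.trans (Category.assoc _ _ _).symm

/-- A pair of mutually inverse generalized morphisms defines a generalized element of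
`iso(B)₁`. -/
def isoLift (B : InternalCategory C) {X : C} (f g : X ⟶ B.A₁)
    (h₁ : f ≫ B.t = g ≫ B.s) (h₂ : g ≫ B.t = f ≫ B.s)
    (h₃ : B.comp f g h₁ = f ≫ B.s ≫ B.e) (h₄ : B.comp g f h₂ = f ≫ B.t ≫ B.e) :
    X ⟶ B.iso₁ :=
  equalizer.lift (pullback.lift f g (by ext <;> simp [h₁, h₂])) (by
    ext
    · simpa [precomp_comp] using h₃
    · simpa [precomp_comp] using h₄)

@[simp]
lemma isoLift_isoHom (B : InternalCategory C) {X : C} (f g : X ⟶ B.A₁)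
    (h₁ : f ≫ B.t = g ≫ B.s) (h₂ : g ≫ B.t = f ≫ B.s)
    (h₃ : B.comp f g h₁ = f ≫ B.s ≫ B.e) (h₄ : B.comp g f h₂ = f ≫ B.t ≫ B.e) :
    B.isoLift f g h₁ h₂ h₃ h₄ ≫ B.isoHom = f := by
  simp [isoLift, isoHom]

/-- The morphism `iso(F)₁ : iso(A)₁ ⟶ iso(B)₁` induced by an internal functor. -/
def isoMap {A B : InternalCategory C} (F : A ⟶ B) : A.iso₁ ⟶ B.iso₁ :=
  B.isoLift (A.isoHom ≫ F.F₁) (A.isoInv ≫ F.F₁)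
    (by simp only [Category.assoc, F.map_s, F.map_t, reassoc_of% A.isoInv_s])
    (by simp only [Category.assoc, F.map_s, F.map_t, reassoc_of% A.isoInv_t])
    (by rw [← Hom.comp_F₁ F _ _ A.isoInv_s.symm, isoHom_comp_isoInv]
        simp only [Category.assoc, F.map_e, reassoc_of% F.map_s])
    (by rw [← Hom.comp_F₁ F _ _ A.isoInv_t, isoInv_comp_isoHom]
        simp only [Category.assoc, F.map_e, reassoc_of% F.map_t])

/-- The mapping path object `(P_F)₀`, the pullback of `F₀ : A₀ ⟶ B₀` and the target
`iso(B)₁ ⟶ B₀`. -/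
abbrev pathObj {A B : InternalCategory C} (F : A ⟶ B) : C :=
  pullback F.F₀ (B.isoHom ≫ B.t)

/-- The morphism `(P_F)₀ ⟶ iso(B)₁ ⟶ B₀` sending `(a, b ≅ F a)` to `b`. -/
def pathSource {A B : InternalCategory C} (F : A ⟶ B) : pathObj F ⟶ B.A₀ :=
  pullback.snd F.F₀ (B.isoHom ≫ B.t) ≫ B.isoHom ≫ B.s

/-- The morphism `(r_F)₀ : iso(A)₁ ⟶ (P_F)₀` induced by the target `iso(A)₁ ⟶ A₀` and by
`iso(F)₁`. -/
def pathComparison {A B : InternalCategory C} (F : A ⟶ B) : A.iso₁ ⟶ pathObj F :=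
  pullback.lift (A.isoHom ≫ A.t) (isoMap F)
    (by simp only [isoMap, Category.assoc, ← F.map_t]
        rw [← Category.assoc (B.isoLift _ _ _ _ _ _), isoLift_isoHom, Category.assoc])

/-! ### The classes of morphisms attached to a Grothendieck topology -/

/-- `p` is a `T`-epimorphism if its image under the Yoneda embedding followed by sheafification
is an epimorphism of `T`-sheaves. As the site may be large, the sheaves take values in a
universe of sets in which the site is small. -/
def topologyEpi (T : GrothendieckTopology C) : MorphismProperty C := fun _ _ p ↦
  Epi ((presheafToSheaf T (Type (max u v))).map (uliftYoneda.{u}.map p))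

/-- `F` is fully faithful if `A₁` is the pullback of `B₁` along `F₀ × F₀`. -/
def fullyFaithful : MorphismProperty (InternalCategory C) := fun A B F ↦
  IsPullback F.F₁ (prod.lift A.s A.t) (prod.lift B.s B.t) (prod.map F.F₀ F.F₀)

/-- `F` is essentially `T`-surjective if `(P_F)₀ ⟶ B₀` is a `T`-epimorphism. -/
def essSurjective (T : GrothendieckTopology C) : MorphismProperty (InternalCategory C) :=
  fun _ _ F ↦ topologyEpi T (pathSource F)

/-- The class `we(T)` of `T`-equivalences. -/
def topologyEquivalences (T : GrothendieckTopology C) : MorphismProperty (InternalCategory C) :=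
  fullyFaithful ⊓ essSurjective T

/-- The class `fib(T)` of `T`-fibrations. -/
def topologyFibrations (T : GrothendieckTopology C) : MorphismProperty (InternalCategory C) :=
  fun _ _ F ↦ topologyEpi T (pathComparison F)

/-- The class `cof(T)` of `T`-cofibrations: the morphisms with the left lifting property with
respect to all acyclic `T`-fibrations. -/
def topologyCofibrations (T : GrothendieckTopology C) : MorphismProperty (InternalCategory C) :=
  (topologyFibrations T ⊓ topologyEquivalences T).llp

/-- `M` is the model structure on internal categories induced by the topology `T`. -/
structure IsInducedByTopology (T : GrothendieckTopology C)
    (M : ModelCategory (InternalCategory C)) : Prop where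
  weakEquivalences_eq : weakEquivalences (InternalCategory C) = topologyEquivalences T
  fibrations_eq : fibrations (InternalCategory C) = topologyFibrations T
  cofibrations_eq : cofibrations (InternalCategory C) = topologyCofibrations T

end InternalCategory

end Internal

/-! ### Double categories and the vertical nerve -/

/-- Small double categories: category objects in the category of small categories. The category
`A₀` consists of the objects and the vertical morphisms, and the category `A₁` of the horizontal
morphisms and the squares, under vertical composition; `m` is horizontal composition. -/
abbrev DblCat : Type (u + 1) := InternalCategory Cat.{u, u}

/-- The functor sending `[n]` to the ordinal `{0 < 1 < ⋯ < n}` seen as a (small) category. -/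
def ordinalCat : SimplexCategory ⥤ Cat.{u, u} :=
  SimplexCategory.toPartOrd.{u} ⋙ forget₂ PartOrd Preord ⋙ preordToCat

/-- The vertical nerve. The objects of `(N_v D)_n` are the functors `[n] ⥤ D₀`, that is, the
strings of `n` composable vertical morphisms; the morphisms are the functors `[n] ⥤ D₁`, that is,
the vertical strings of `n` composable squares (for `n = 0`, the horizontal morphisms), and they
are composed horizontally. -/
def verticalNerve : DblCat.{u} ⥤ SimplicialObject Cat.{u, u} :=
  InternalCategory.pointsFunctor ⋙
    (Functor.whiskeringLeft SimplexCategoryᵒᵖ Cat.{u, u}ᵒᵖ Cat.{u, u}).obj ordinalCat.op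

/-! ### The simplicially surjective topology -/

/-- A functor is simplicially surjective if it is surjective on `k`-simplices of nerves for
all `k`. -/
def simpliciallySurjective : MorphismProperty Cat.{u, u} := fun _ _ F ↦
  ∀ k : ℕ, Function.Surjective ((nerveFunctor.map F).app (op ⦋k⦌))

lemma simpliciallySurjective_iff {D E : Cat.{u, u}} (F : D ⟶ E) :
    simpliciallySurjective F ↔
      ∀ (k : ℕ) (x : ordinalCat.{u}.obj ⦋k⦌ ⟶ E), ∃ y, y ≫ F = x := by
  let up (k : ℕ) : Fin (k + 1) ⥤ ULift.{u} (Fin (k + 1)) :=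
    Monotone.functor (f := ULift.up) fun _ _ h ↦ h
  let down (k : ℕ) : ULift.{u} (Fin (k + 1)) ⥤ Fin (k + 1) :=
    Monotone.functor (f := ULift.down) fun _ _ h ↦ h
  constructor
  · intro h k x
    obtain ⟨y, hy⟩ := h k (up k ⋙ x.toFunctor)
    replace hy : y ⋙ F.toFunctor = up k ⋙ x.toFunctor := hy
    refine ⟨(down k ⋙ y).toCatHom, Cat.ext ?_⟩
    exact congrArg (fun G ↦ down k ⋙ G) hy
  · intro h k x
    obtain ⟨y, hy⟩ := h k (down k ⋙ x).toCatHom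
    replace hy : y.toFunctor ⋙ F.toFunctor = down k ⋙ x := congr(($hy).toFunctor)
    refine ⟨up k ⋙ y.toFunctor, ?_⟩
    exact congrArg (fun G ↦ up k ⋙ G) hy

/-- The basis of the simplicially surjective topology: the covering families of `X` are the
families consisting of a single simplicially surjective functor with codomain `X`. -/
def simpliciallySurjectiveBasis : Pretopology Cat.{u, u} where
  coverings X := {S | ∃ (Y : Cat.{u, u}) (F : Y ⟶ X),
    simpliciallySurjective F ∧ S = Presieve.singleton F}
  has_isos X Y F _ := ⟨Y, F, (simpliciallySurjective_iff F).2 fun _ x ↦ ⟨x ≫ inv F, by simp⟩, rfl⟩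
  pullbacks X Y G := by
    rintro _ ⟨Z, F, hF, rfl⟩
    refine ⟨pullback F G, pullback.snd F G, ?_, Presieve.pullback_singleton G F⟩
    rw [simpliciallySurjective_iff] at hF ⊢
    intro k x
    obtain ⟨y, hy⟩ := hF k (x ≫ G)
    exact ⟨pullback.lift y x hy, pullback.lift_snd _ _ _⟩
  transitive X := by
    rintro _ T ⟨Y, F, hF, rfl⟩ hT
    obtain ⟨Z, G, hG, h⟩ := hT F (Presieve.singleton_self F)
    refine ⟨Z, G ≫ F, ?_, ?_⟩
    · rw [simpliciallySurjective_iff] at hF hG ⊢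
      intro k x
      obtain ⟨y, rfl⟩ := hF k x
      obtain ⟨z, rfl⟩ := hG k y
      exact ⟨z, by simp⟩
    · funext W
      ext H
      constructor
      · rintro ⟨V, G', F', hF', hG', rfl⟩
        cases hF'
        rw [h] at hG'
        cases hG'
        exact ⟨⟩
      · rintro ⟨⟩
        exact ⟨_, G, F, ⟨⟩, by rw [h]; exact ⟨⟩, rfl⟩

/-- The simplicially surjective topology `τ` on the category of small categories. -/
def simpliciallySurjectiveTopology : GrothendieckTopology Cat.{u, u} :=
  simpliciallySurjectiveBasis.toGrothendieck

/-! ### The diagram categorical structure and its transfer -/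

/-- A functor `F` is an isofibration if every isomorphism `b ≅ F a` lifts to an isomorphism
`a' ≅ a`. -/
def IsIsofibration {D : Type*} [Category* D] {E : Type*} [Category* E] (F : D ⥤ E) : Prop :=
  ∀ (a : D) (b : E) (g : b ≅ F.obj a),
    ∃ (a' : D) (f : a' ≅ a) (h : F.obj a' = b), F.map f.hom = eqToHom h ≫ g.hom

/-- `M` is the diagram structure on simplicial categories associated with the categorical model
structure on `Cat`: the weak equivalences are the levelwise equivalences of categories, and the
fibrations are the levelwise isofibrations. -/
structure IsDiagramCategorical (M : ModelCategory (SimplicialObject Cat.{u, u})) : Prop where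
  weakEquivalences_iff : ∀ {X Y : SimplicialObject Cat.{u, u}} (f : X ⟶ Y),
    weakEquivalences _ f ↔ ∀ n, (f.app n).toFunctor.IsEquivalence
  fibrations_iff : ∀ {X Y : SimplicialObject Cat.{u, u}} (f : X ⟶ Y),
    fibrations _ f ↔ ∀ n, IsIsofibration (f.app n).toFunctor

/-- The model structure `N` on `D` is the transfer of the model structure `M` on `C` across the
adjunction `L ⊣ R`: the functor `R` creates weak equivalences and fibrations, and `L` carries
generating cofibrations and generating acyclic cofibrations of `M` to such classes for `N`. -/
structure IsTransferred {C D : Type*} [Category* C] [Category* D] {L : C ⥤ D} {R : D ⥤ C}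
    (_adj : L ⊣ R) (M : ModelCategory C) (N : ModelCategory D) : Prop where
  weakEquivalences_iff : ∀ {X Y : D} (f : X ⟶ Y),
    weakEquivalences D f ↔ weakEquivalences C (R.map f)
  fibrations_iff : ∀ {X Y : D} (f : X ⟶ Y), fibrations D f ↔ fibrations C (R.map f)
  rlp_map_generating : ∀ I : MorphismProperty C, I.rlp = trivialFibrations C →
    (I.map L).rlp = trivialFibrations D
  rlp_map_generating_acyclic : ∀ J : MorphismProperty C, J.rlp = fibrations C →
    (J.map L).rlp = fibrations D

end

-- Both model structures are instances of one construction. Let `C` have finite limits and let `ι :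
-- S ⥤ C` be a functor whose points `ι n ⟶ X` determine the morphisms of `C` (`IsPointDense`). An
-- internal category in `C` has a category of `ι`-points for each `n`, and the resulting functor
-- `pointsNerve ι` to presheaves of categories is fully faithful. For the ordinals in `Cat` it is
-- the vertical nerve; for the standard simplices in `SSet` it is an equivalence onto simplicial
-- categories.
--
-- A point of the mapping path object of `F` is an isomorphism `b ≅ F a`, and a point of `iso₁` is
-- an isomorphism. Hence surjectivity on points of the two comparison maps says that `F` is
-- essentially surjective, respectively an isofibration, on each category of points
-- (`nerveEquivalences_iff`, `nerveFibrations_iff`). Since `τ` is generated by single simplicially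
-- surjective functors, a functor is `τ`-epi exactly when it is surjective on simplices
-- (`topologyEpi_simpliciallySurjectiveTopology_iff`). So the `τ`-classes are the levelwise classes,
-- and the structures in 1 and 2 coincide.
--
-- No small object argument is needed for the axioms. Acyclic fibrations are the fully faithful
-- internal functors that are surjective on points of objects (`nerve_acyclicFibrations_iff`), so
-- one factorization is obtained by adjoining all points of `B₀` to `A₀` as new objects and pulling
-- back the morphisms of `B`. The other is the mapping path factorization. The lifting of acyclic
-- cofibrations against fibrations is then formal (`hasLiftingProperty_of_factorization`).
--
-- Limits, colimits and the left adjoint `c_v` come from local presentability. The image of the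
-- vertical nerve consists of the simplicial categories whose simplicial sets of objects and of
-- arrows satisfy the Segal condition; this is locality for a small set of maps, so the image is
-- reflective. The same argument with nerves of categories in `SSet` shows that `Cat` is locally
-- presentable. The statement on generating classes is the transposition of lifting problems across
-- the adjunction.

universe w

noncomputable section

/-! ### Model structures from right classes -/

section ModelStructure

variable {D : Type*} [Category* D]

/-- A morphism with the left lifting property against acyclic fibrations which is a weak
equivalence lifts against all fibrations. -/
lemma hasLiftingProperty_of_factorization [HasPullbacks D] (W Fib : MorphismProperty D)
    [W.HasTwoOutOfThreeProperty] [Fib.IsStableUnderComposition] [Fib.IsStableUnderBaseChange]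
    [W.HasFactorization Fib] {A B X Y : D} (i : A ⟶ B) (p : X ⟶ Y)
    (hi : (Fib ⊓ W).llp i) (hi' : W i) (hp : Fib p) : HasLiftingProperty i p := by
  refine ⟨fun {f g} sq ↦ ?_⟩
  -- Factor `A ⟶ X ×_Y B` as a weak equivalence followed by a fibration. The resulting fibration
  -- onto `B` is acyclic by two-out-of-three, because both `i` and the first factor are weak
  -- equivalences. Lifting `i` against it gives a section over `B`, whose projection to `X` is the
  -- required diagonal.
  let s : A ⟶ pullback p g := pullback.lift f i sq.w
  let h := MorphismProperty.factorizationData W Fib s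
  have hs : h.i ≫ h.p ≫ pullback.snd p g = i := by rw [h.fac_assoc]; exact pullback.lift_snd _ _ _
  have hq : Fib (h.p ≫ pullback.snd p g) :=
    Fib.comp_mem _ _ h.hp (MorphismProperty.pullback_snd p g hp)
  have hq' : W (h.p ≫ pullback.snd p g) := W.of_precomp h.i _ h.hi (by rwa [hs])
  have := hi _ ⟨hq, hq'⟩
  have sq' : CommSq h.i i (h.p ≫ pullback.snd p g) (𝟙 B) := ⟨by rw [hs, Category.comp_id]⟩
  have e₁ : sq'.lift ≫ h.p ≫ pullback.snd p g = 𝟙 B := sq'.fac_right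
  refine ⟨⟨⟨sq'.lift ≫ h.p ≫ pullback.fst p g, ?_, ?_⟩⟩⟩
  · rw [sq'.fac_left_assoc, h.fac_assoc]
    exact pullback.lift_fst _ _ _
  · rw [Category.assoc, Category.assoc, pullback.condition]
    rw [reassoc_of% e₁]

/-- The model structure determined by weak equivalences and fibrations, for which the
cofibrations are the morphisms with the left lifting property against acyclic fibrations. -/
abbrev modelCategoryOfFactorizations [HasFiniteLimits D] [HasFiniteColimits D]
    (W Fib : MorphismProperty D) [W.HasTwoOutOfThreeProperty] [W.IsStableUnderRetracts]
    [Fib.IsStableUnderRetracts] [Fib.IsStableUnderComposition] [Fib.IsStableUnderBaseChange]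
    [W.HasFactorization Fib] [(Fib ⊓ W).llp.HasFactorization (Fib ⊓ W)] : ModelCategory D :=
  { categoryWithFibrations := ⟨Fib⟩
    categoryWithCofibrations := ⟨(Fib ⊓ W).llp⟩
    categoryWithWeakEquivalences := ⟨W⟩
    cm1a := inferInstance
    cm1b := inferInstance
    cm2 := (inferInstance : W.HasTwoOutOfThreeProperty)
    cm3a := (inferInstance : W.IsStableUnderRetracts)
    cm3b := (inferInstance : Fib.IsStableUnderRetracts)
    cm3c := (inferInstance : (Fib ⊓ W).llp.IsStableUnderRetracts)
    cm4a i p hi hi' hp := by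
      have h₁ : (Fib ⊓ W).llp i := hi.mem
      exact hasLiftingProperty_of_factorization W Fib i p h₁ hi'.mem hp.mem
    cm4b i p hi hp hp' := by
      have h₁ : (Fib ⊓ W).llp i := hi.mem
      exact h₁ p ⟨hp.mem, hp'.mem⟩
    -- Refactoring the weak equivalence as a cofibration followed by an acyclic fibration makes the
    -- first factor a cofibration; two-out-of-three keeps it a weak equivalence.
    cm5a := ⟨fun f ↦ by
      let h := MorphismProperty.factorizationData W Fib f
      let h' := MorphismProperty.factorizationData (Fib ⊓ W).llp (Fib ⊓ W) h.i
      exact ⟨{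
        Z := h'.Z
        i := h'.i
        p := h'.p ≫ h.p
        hi := ⟨h'.hi, W.of_postcomp h'.i h'.p h'.hp.2 (by rw [h'.fac]; exact h.hi)⟩
        hp := Fib.comp_mem _ _ h'.hp.1 h.hp }⟩⟩
    cm5b := (inferInstance : (Fib ⊓ W).llp.HasFactorization (Fib ⊓ W)) }

end ModelStructure

/-! ### Isofibrations and equivalences of categories -/

/-- The inclusion of the codomain into the free-living isomorphism. -/
def walkingIsoOne : Cat.of (Discrete PUnit.{u + 1}) ⟶
    Cat.of (ULiftHom.{u} WalkingIso.{u}) :=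
  ((Functor.const _).obj (ULiftHom.up.obj WalkingIso.one.{u})).toCatHom

lemma discretePUnit_functor_ext {D : Type*} [Category* D] {F G : Discrete PUnit.{u + 1} ⥤ D}
    (h : F.obj ⟨⟨⟩⟩ = G.obj ⟨⟨⟩⟩) : F = G :=
  CategoryTheory.Functor.ext (fun ⟨⟨⟩⟩ ↦ h) (fun x y m ↦ by
    obtain rfl : x = y := Subsingleton.elim _ _
    obtain rfl : m = 𝟙 _ := Subsingleton.elim _ _
    simp)

/-- The value on the backward arrow is forced, since an inverse is unique; only the forward arrow
has to be compared. -/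
lemma uliftHom_walkingIso_functor_ext {D : Type*} [Category* D]
    {F G : ULiftHom.{u} WalkingIso.{u} ⥤ D}
    (h₀ : F.obj (ULiftHom.up.obj WalkingIso.zero) = G.obj (ULiftHom.up.obj WalkingIso.zero))
    (h₁ : F.obj (ULiftHom.up.obj WalkingIso.one) = G.obj (ULiftHom.up.obj WalkingIso.one))
    (h : F.map (ULiftHom.up.map WalkingIso.iso.hom) =
      eqToHom h₀ ≫ G.map (ULiftHom.up.map WalkingIso.iso.hom) ≫ eqToHom h₁.symm) : F = G := by
  have key : ULiftHom.up ⋙ F = ULiftHom.up ⋙ G := by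
    have aux {a b a' b' : D} (e : a ≅ b) (e' : a' ≅ b') (h₀ : a = a') (h₁ : b = b')
        (h : e.hom = eqToHom h₀ ≫ e'.hom ≫ eqToHom h₁.symm) :
        (⟨a, b, e⟩ : Σ (X : D) (Y : D), (X ≅ Y)) = ⟨a', b', e'⟩ := by
      subst h₀ h₁
      obtain rfl : e = e' := Iso.ext (by simpa using h)
      rfl
    exact WalkingIso.equiv.injective (aux _ _ h₀ h₁ h)
  exact congrArg (fun H ↦ ULiftHom.down ⋙ H) key

/-- A lifting problem consists of an object `a` and an isomorphism ending at the image of `a`. The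
lifting form gives stability under retracts, composition and base change at no cost. -/
lemma isIsofibration_iff_hasLiftingProperty {X Y : Cat.{u, u}} (F : X ⟶ Y) :
    IsIsofibration F.toFunctor ↔ HasLiftingProperty walkingIsoOne F := by
  constructor
  · intro h
    refine ⟨fun {f g} sq ↦ ?_⟩
    have w : f.toFunctor ⋙ F.toFunctor = walkingIsoOne.toFunctor ⋙ g.toFunctor :=
      congr(($(sq.w)).toFunctor)
    let G : ULiftHom.{u} WalkingIso.{u} ⥤ Y := g.toFunctor
    have w₀ : F.toFunctor.obj (f.toFunctor.obj ⟨⟨⟩⟩) = G.obj (ULiftHom.up.obj .one) :=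
      Functor.congr_obj w ⟨⟨⟩⟩
    obtain ⟨a, k, h₀, h₁⟩ := h (f.toFunctor.obj ⟨⟨⟩⟩) _
      ((G.mapIso (ULiftHom.up.mapIso WalkingIso.iso)) ≪≫ eqToIso w₀.symm)
    refine ⟨⟨⟨(ULiftHom.down ⋙ WalkingIso.fromIso k).toCatHom, Cat.ext ?_, Cat.ext ?_⟩⟩⟩
    · exact discretePUnit_functor_ext rfl
    · exact uliftHom_walkingIso_functor_ext h₀ w₀ h₁
  · intro h a b g
    have sq : CommSq ((Functor.const _).obj a).toCatHom walkingIsoOne F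
        (ULiftHom.down ⋙ WalkingIso.fromIso g).toCatHom :=
      ⟨Cat.ext (discretePUnit_functor_ext rfl)⟩
    have : sq.HasLift := h.sq_hasLift sq
    have w₁ : walkingIsoOne.toFunctor ⋙ sq.lift.toFunctor = (Functor.const _).obj a :=
      congr(($(sq.fac_left)).toFunctor)
    obtain ⟨L, ha, w₂⟩ : ∃ L : ULiftHom.{u} WalkingIso.{u} ⥤ X,
        L.obj (ULiftHom.up.obj WalkingIso.one) = a ∧
          L ⋙ F.toFunctor = ULiftHom.down ⋙ WalkingIso.fromIso g :=
      ⟨sq.lift.toFunctor, Functor.congr_obj w₁ ⟨⟨⟩⟩, congr(($(sq.fac_right)).toFunctor)⟩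
    subst ha
    refine ⟨L.obj (ULiftHom.up.obj WalkingIso.zero),
      L.mapIso (ULiftHom.up.mapIso WalkingIso.iso),
      Functor.congr_obj w₂ (ULiftHom.up.obj WalkingIso.zero), ?_⟩
    exact (Functor.congr_hom w₂ (ULiftHom.up.map WalkingIso.iso.hom)).trans
      (congrArg _ (Category.comp_id _))

/-- The class of isofibrations between small categories. -/
def isofibrations : MorphismProperty Cat.{u, u} := fun _ _ F ↦ IsIsofibration F.toFunctor

lemma isofibrations_eq_rlp : isofibrations.{u} =
    (MorphismProperty.ofHoms fun _ : Unit ↦ walkingIsoOne.{u}).rlp := by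
  ext X Y F
  rw [isofibrations, isIsofibration_iff_hasLiftingProperty]
  exact ⟨fun h _ _ _ hf ↦ by cases hf; exact h, fun h ↦ h _ (MorphismProperty.ofHoms.mk ())⟩

instance : isofibrations.{u}.IsStableUnderRetracts := by
  rw [isofibrations_eq_rlp]; infer_instance

instance : isofibrations.{u}.IsStableUnderComposition := by
  rw [isofibrations_eq_rlp]; infer_instance

instance : isofibrations.{u}.IsStableUnderBaseChange := by
  rw [isofibrations_eq_rlp]; infer_instance

/-- The class of equivalences between small categories. -/
def catEquivalences : MorphismProperty Cat.{u, u} := fun _ _ F ↦ F.toFunctor.IsEquivalence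

instance : catEquivalences.{u}.HasTwoOutOfThreeProperty where
  comp_mem F G hF hG := by
    have : F.toFunctor.IsEquivalence := hF
    have : G.toFunctor.IsEquivalence := hG
    exact inferInstanceAs (F.toFunctor ⋙ G.toFunctor).IsEquivalence
  of_postcomp F G hG hFG := by
    have : G.toFunctor.IsEquivalence := hG
    have : (F.toFunctor ⋙ G.toFunctor).IsEquivalence := hFG
    exact Functor.isEquivalence_of_comp_right F.toFunctor G.toFunctor
  of_precomp F G hF hFG := by
    have : F.toFunctor.IsEquivalence := hF
    have : (F.toFunctor ⋙ G.toFunctor).IsEquivalence := hFG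
    exact Functor.isEquivalence_of_comp_left F.toFunctor G.toFunctor

instance : catEquivalences.{u}.IsStableUnderRetracts where
  of_retract {X Y Z W f g} h hg := by
    have : g.toFunctor.IsEquivalence := hg
    let iX := h.i.left.toFunctor
    let iY := h.i.right.toFunctor
    let rX := h.r.left.toFunctor
    let rY := h.r.right.toFunctor
    have hi : iX ⋙ g.toFunctor = f.toFunctor ⋙ iY := congr(($(h.i.w)).toFunctor)
    have hr : rX ⋙ f.toFunctor = g.toFunctor ⋙ rY := congr(($(h.r.w)).toFunctor)
    have hX : iX ⋙ rX = 𝟭 _ := congr(($(h.retract_left)).toFunctor)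
    have hY : iY ⋙ rY = 𝟭 _ := congr(($(h.retract_right)).toFunctor)
    -- A quasi-inverse of the retract: include, apply a quasi-inverse of `g`, retract.
    let k := iY ⋙ g.toFunctor.inv ⋙ rX
    let e₁ : 𝟭 _ ≅ f.toFunctor ⋙ k :=
      eqToIso hX.symm ≪≫
      Functor.isoWhiskerLeft iX (Functor.isoWhiskerRight g.toFunctor.asEquivalence.unitIso rX) ≪≫
      eqToIso (congrArg (· ⋙ (g.toFunctor.inv ⋙ rX)) hi)
    let e₂ : k ⋙ f.toFunctor ≅ 𝟭 _ :=
      eqToIso (congrArg (fun G ↦ iY ⋙ g.toFunctor.inv ⋙ G) hr) ≪≫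
      Functor.isoWhiskerLeft iY
        (Functor.isoWhiskerRight g.toFunctor.asEquivalence.counitIso rY) ≪≫ eqToIso hY
    exact (CategoryTheory.Equivalence.mk f.toFunctor k e₁ e₂).isEquivalence_functor

/-! ### Dense families of points and the nerve of an internal category -/

namespace CategoryTheory.Functor

/-- A functor `ι : S ⥤ C` is point-dense if the morphisms `X ⟶ Y` in `C` are the natural maps
between the `ι`-points `ι n ⟶ X` and `ι n ⟶ Y`, i.e. if the restricted Yoneda functor is fully
faithful. -/
class IsPointDense {S C : Type*} [Category* S] [Category* C] (ι : S ⥤ C) : Prop where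
  hom_ext {X Y : C} {f g : X ⟶ Y} (h : ∀ (n : S) (z : ι.obj n ⟶ X), z ≫ f = z ≫ g) : f = g
  exists_hom {X Y : C} (φ : ∀ n : S, (ι.obj n ⟶ X) → (ι.obj n ⟶ Y))
    (hφ : ∀ (m n : S) (a : m ⟶ n) (z : ι.obj n ⟶ X), φ m (ι.map a ≫ z) = ι.map a ≫ φ n z) :
    ∃ f : X ⟶ Y, ∀ (n : S) (z : ι.obj n ⟶ X), z ≫ f = φ n z

/-- This is the Yoneda lemma; it makes constructions on all generalized elements a special case of
those on `ι`-points. -/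
instance {C : Type*} [Category* C] : (𝟭 C).IsPointDense where
  hom_ext {X Y f g} h := by simpa using h X (𝟙 X)
  exists_hom φ hφ := ⟨φ _ (𝟙 _), fun n z ↦ by simpa using (hφ _ _ z (𝟙 _)).symm⟩

variable {S C : Type*} [Category* S] [Category* C] (ι : S ⥤ C) [ι.IsPointDense]

/-- The morphism determined by its action on `ι`-points. -/
def homOfPoints {X Y : C} (φ : ∀ n : S, (ι.obj n ⟶ X) → (ι.obj n ⟶ Y))
    (hφ : ∀ (m n : S) (a : m ⟶ n) (z : ι.obj n ⟶ X), φ m (ι.map a ≫ z) = ι.map a ≫ φ n z) :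
    X ⟶ Y :=
  (IsPointDense.exists_hom φ hφ).choose

lemma comp_homOfPoints {X Y : C} (φ : ∀ n : S, (ι.obj n ⟶ X) → (ι.obj n ⟶ Y))
    (hφ : ∀ (m n : S) (a : m ⟶ n) (z : ι.obj n ⟶ X), φ m (ι.map a ≫ z) = ι.map a ≫ φ n z)
    {n : S} (z : ι.obj n ⟶ X) : z ≫ ι.homOfPoints φ hφ = φ n z :=
  (IsPointDense.exists_hom φ hφ).choose_spec n z

/-- The pointwise inverse bijections are compatible with restriction along `ι`, so by density they
come from a morphism. -/
lemma isIso_of_bijective_points {X Y : C} (f : X ⟶ Y)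
    (h : ∀ n : S, Function.Bijective fun z : ι.obj n ⟶ X ↦ z ≫ f) : IsIso f := by
  let e (n : S) := Equiv.ofBijective _ (h n)
  have he (n : S) (y : ι.obj n ⟶ Y) : (e n).symm y ≫ f = y := (e n).apply_symm_apply y
  have he' (n : S) (x : ι.obj n ⟶ X) : (e n).symm (x ≫ f) = x := (e n).symm_apply_apply x
  let g : Y ⟶ X := ι.homOfPoints (fun n ↦ (e n).symm) (fun m n a z ↦ by
    rw [Equiv.symm_apply_eq]
    exact ((Category.assoc _ _ _).trans (congrArg _ (he n z))).symm)
  refine ⟨g, ?_, ?_⟩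
  · refine IsPointDense.hom_ext (ι := ι) fun n z ↦ ?_
    rw [← Category.assoc, ι.comp_homOfPoints, he', Category.comp_id]
  · refine IsPointDense.hom_ext (ι := ι) fun n z ↦ ?_
    rw [← Category.assoc, ι.comp_homOfPoints, he, Category.comp_id]

end CategoryTheory.Functor

namespace InternalCategory

variable {C : Type u} [Category.{v} C] [HasFiniteLimits C] {S : Type*} [Category* S] (ι : S ⥤ C)

/-- The presheaf of categories of `ι`-points of an internal category. -/
def pointsNerve : InternalCategory C ⥤ Sᵒᵖ ⥤ Cat.{v, v} :=
  pointsFunctor ⋙ (Functor.whiskeringLeft Sᵒᵖ Cᵒᵖ Cat.{v, v}).obj ι.op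

variable {ι}

lemma comp_fst_snd (A : InternalCategory C) {X : C} (z : X ⟶ pullback A.t A.s) :
    A.comp (z ≫ pullback.fst _ _) (z ≫ pullback.snd _ _)
      (by rw [Category.assoc, Category.assoc, pullback.condition]) = z ≫ A.m := by
  have h : pullback.lift (z ≫ pullback.fst A.t A.s) (z ≫ pullback.snd A.t A.s)
      (by rw [Category.assoc, Category.assoc, pullback.condition]) = z :=
    pullback.hom_ext (pullback.lift_fst _ _ _) (pullback.lift_snd _ _ _)
  rw [comp, h]

/-- The object part of a map between nerves. -/
def nerveMapObj {A B : InternalCategory C} (α : (pointsNerve ι).obj A ⟶ (pointsNerve ι).obj B)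
    {n : S} (z : ι.obj n ⟶ A.A₀) : ι.obj n ⟶ B.A₀ :=
  ((α.app (op n)).toFunctor.obj (⟨z⟩ : Points A (ι.obj n)) : Points B (ι.obj n)).pt

/-- A point of `A₁` as a morphism between points of `A₀`. -/
def homMk (A : InternalCategory C) {X : C} (f : X ⟶ A.A₁) :
    (⟨f ≫ A.s⟩ : Points A X) ⟶ ⟨f ≫ A.t⟩ := ⟨f, rfl, rfl⟩

/-- The morphism part of a map between nerves. -/
def nerveMapHom {A B : InternalCategory C} (α : (pointsNerve ι).obj A ⟶ (pointsNerve ι).obj B)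
    {n : S} (z : ι.obj n ⟶ A.A₁) : ι.obj n ⟶ B.A₁ :=
  ((α.app (op n)).toFunctor.map (A.homMk z) :
    ((α.app (op n)).toFunctor.obj (⟨z ≫ A.s⟩ : Points A (ι.obj n)) : Points B (ι.obj n)) ⟶
    ((α.app (op n)).toFunctor.obj (⟨z ≫ A.t⟩ : Points A (ι.obj n)) : Points B (ι.obj n))).1

/-- The endpoints of a morphism of points are determined by its underlying morphism, so they may be
taken to be its source and target on the nose. -/
lemma nerveMapHom_val {A B : InternalCategory C}
    (α : (pointsNerve ι).obj A ⟶ (pointsNerve ι).obj B)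
    {n : S} {a b : Points A (ι.obj n)} (f : a ⟶ b) :
    nerveMapHom α f.1 = ((α.app (op n)).toFunctor.map f :
      ((α.app (op n)).toFunctor.obj a : Points B (ι.obj n)) ⟶
      ((α.app (op n)).toFunctor.obj b : Points B (ι.obj n))).1 := by
  obtain ⟨f, hs, ht⟩ := f
  obtain rfl : (⟨f ≫ A.s⟩ : Points A (ι.obj n)) = a := Points.ext hs
  obtain rfl : (⟨f ≫ A.t⟩ : Points A (ι.obj n)) = b := Points.ext ht
  rfl

section

variable {A B : InternalCategory C} (α : (pointsNerve ι).obj A ⟶ (pointsNerve ι).obj B)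

lemma nerveMapHom_s {n : S} (z : ι.obj n ⟶ A.A₁) :
    nerveMapHom α z ≫ B.s = nerveMapObj α (z ≫ A.s) :=
  ((α.app (op n)).toFunctor.map (A.homMk z) :
    ((α.app (op n)).toFunctor.obj (⟨z ≫ A.s⟩ : Points A (ι.obj n)) : Points B (ι.obj n)) ⟶
    ((α.app (op n)).toFunctor.obj (⟨z ≫ A.t⟩ : Points A (ι.obj n)) : Points B (ι.obj n))).2.1

lemma nerveMapHom_t {n : S} (z : ι.obj n ⟶ A.A₁) :
    nerveMapHom α z ≫ B.t = nerveMapObj α (z ≫ A.t) :=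
  ((α.app (op n)).toFunctor.map (A.homMk z) :
    ((α.app (op n)).toFunctor.obj (⟨z ≫ A.s⟩ : Points A (ι.obj n)) : Points B (ι.obj n)) ⟶
    ((α.app (op n)).toFunctor.obj (⟨z ≫ A.t⟩ : Points A (ι.obj n)) : Points B (ι.obj n))).2.2

lemma nerveMapHom_e {n : S} (z : ι.obj n ⟶ A.A₀) :
    nerveMapHom α (z ≫ A.e) = nerveMapObj α z ≫ B.e :=
  (nerveMapHom_val α (𝟙 (⟨z⟩ : Points A (ι.obj n)))).trans
    (congrArg Subtype.val ((α.app (op n)).toFunctor.map_id (⟨z⟩ : Points A (ι.obj n))))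

lemma nerveMapHom_comp {n : S} (z w : ι.obj n ⟶ A.A₁) (h : z ≫ A.t = w ≫ A.s) :
    nerveMapHom α (A.comp z w h) = B.comp (nerveMapHom α z) (nerveMapHom α w)
      (by rw [nerveMapHom_t, nerveMapHom_s, h]) := by
  let f : (⟨z ≫ A.s⟩ : Points A (ι.obj n)) ⟶ ⟨z ≫ A.t⟩ := ⟨z, rfl, rfl⟩
  let g : (⟨z ≫ A.t⟩ : Points A (ι.obj n)) ⟶ ⟨w ≫ A.t⟩ := ⟨w, h.symm, rfl⟩
  have h₁ := congrArg Subtype.val ((α.app (op n)).toFunctor.map_comp f g)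
  refine (nerveMapHom_val α (f ≫ g)).trans (h₁.trans ?_)
  exact B.comp_congr (nerveMapHom_val α f).symm (nerveMapHom_val α g).symm _

lemma nerveMapObj_naturality {m n : S} (a : m ⟶ n) (z : ι.obj n ⟶ A.A₀) :
    nerveMapObj α (ι.map a ≫ z) = ι.map a ≫ nerveMapObj α z :=
  congrArg Points.pt (Functor.congr_obj congr(($(α.naturality a.op)).toFunctor)
    (⟨z⟩ : Points A (ι.obj n)))

lemma nerveMapHom_naturality {m n : S} (a : m ⟶ n) (z : ι.obj n ⟶ A.A₁) :
    nerveMapHom α (ι.map a ≫ z) = ι.map a ≫ nerveMapHom α z := by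
  have h := Functor.congr_hom congr(($(α.naturality a.op)).toFunctor) (A.homMk z)
  have h₁ := congrArg Subtype.val h
  refine (nerveMapHom_val α ((Points.precomp A (ι.map a)).map (A.homMk z))).trans (h₁.trans ?_)
  exact Points.eqToHom_conj_val _ _ _

variable [ι.IsPointDense]

/-- The internal functor determined by a map between nerves. -/
def homOfNerveMap : A ⟶ B where
  F₀ := ι.homOfPoints (fun _ z ↦ nerveMapObj α z) (fun _ _ ↦ nerveMapObj_naturality α)
  F₁ := ι.homOfPoints (fun _ z ↦ nerveMapHom α z) (fun _ _ ↦ nerveMapHom_naturality α)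
  map_s := Functor.IsPointDense.hom_ext (ι := ι) fun n z ↦ by
    rw [← Category.assoc, ← Category.assoc, ι.comp_homOfPoints, ι.comp_homOfPoints, nerveMapHom_s]
  map_t := Functor.IsPointDense.hom_ext (ι := ι) fun n z ↦ by
    rw [← Category.assoc, ← Category.assoc, ι.comp_homOfPoints, ι.comp_homOfPoints, nerveMapHom_t]
  map_e := Functor.IsPointDense.hom_ext (ι := ι) fun n z ↦ by
    rw [← Category.assoc, ← Category.assoc, ι.comp_homOfPoints, ι.comp_homOfPoints, nerveMapHom_e]
  map_m := Functor.IsPointDense.hom_ext (ι := ι) fun n z ↦ by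
    rw [← Category.assoc, ι.comp_homOfPoints, ← A.comp_fst_snd, nerveMapHom_comp]
    refine Eq.trans ?_ (B.precomp_comp z _ _ _).symm
    apply B.comp_congr
    · rw [← Category.assoc, ι.comp_homOfPoints]
    · rw [← Category.assoc, ι.comp_homOfPoints]

lemma pointsNerve_map_homOfNerveMap : (pointsNerve ι).map (homOfNerveMap α) = α := by
  refine NatTrans.ext (funext fun n ↦ Cat.ext (Points.functor_ext (fun z ↦ ?_) fun f ↦ ?_))
  · exact ι.comp_homOfPoints _ (fun _ _ ↦ nerveMapObj_naturality α) _
  · exact (ι.comp_homOfPoints _ (fun _ _ ↦ nerveMapHom_naturality α) _).trans (nerveMapHom_val α f)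

variable (ι) in
instance : (pointsNerve ι).Full where
  map_surjective α := ⟨homOfNerveMap α, pointsNerve_map_homOfNerveMap α⟩

variable (ι) in
instance : (pointsNerve ι).Faithful where
  map_injective {A B F G} h := by
    have h' (n : S) : Points.postcomp F (ι.obj n) = Points.postcomp G (ι.obj n) :=
      congrArg (fun β ↦ (β.app (op n)).toFunctor) h
    apply hom_ext
    · exact Functor.IsPointDense.hom_ext (ι := ι) fun n z ↦
        congrArg Points.pt (Functor.congr_obj (h' n) ⟨z⟩)
    · refine Functor.IsPointDense.hom_ext (ι := ι) fun n z ↦ ?_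
      have := congrArg Subtype.val (Functor.congr_hom (h' n) (A.homMk z))
      exact this.trans (Points.eqToHom_conj_val _ _ _)

end

end InternalCategory

/-! ### Arrows of a category -/

namespace CategoryTheory.Arrow

variable {D E : Type*} [Category* D] [Category* E]

/-- The composite of two composable arrows. -/
def compose (f g : Arrow D) (h : f.right = g.left) : Arrow D :=
  Arrow.mk (f.hom ≫ eqToHom h ≫ g.hom)

lemma compose_congr {f g f' g' : Arrow D} (hf : f = f') (hg : g = g') (h : f.right = g.left) :
    f.compose g h = f'.compose g' (by rw [← hf, ← hg, h]) := by
  subst hf hg; rfl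

lemma mk_compose_mk {a b c : D} (f : a ⟶ b) (g : b ⟶ c) :
    (Arrow.mk f).compose (Arrow.mk g) rfl = Arrow.mk (f ≫ g) := by
  simp [compose]

lemma id_compose (f : Arrow D) : (Arrow.mk (𝟙 f.left)).compose f rfl = f := by
  simp [compose]

lemma compose_id (f : Arrow D) : f.compose (Arrow.mk (𝟙 f.right)) rfl = f := by
  simp [compose]

lemma compose_assoc (f g k : Arrow D) (h : f.right = g.left) (h' : g.right = k.left) :
    (f.compose g h).compose k h' = f.compose (g.compose k h') h := by
  simp [compose]

lemma map_compose (F : D ⥤ E) (f g : Arrow D) (h : f.right = g.left) :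
    F.mapArrow.obj (f.compose g h) =
      (F.mapArrow.obj f).compose (F.mapArrow.obj g) (congrArg F.obj h) := by
  refine congrArg Arrow.mk ((F.map_comp _ _).trans (congrArg _ ((F.map_comp _ _).trans ?_)))
  rw [eqToHom_map]
  rfl

/-- Bundling a morphism with its endpoints erases transport along equalities of objects. This is why
functors below are compared through `Arrow`. -/
lemma mk_eqToHom_conj {a b a' b' : D} (h : a = a') (f : a' ⟶ b') (h' : b' = b) :
    Arrow.mk (eqToHom h ≫ f ≫ eqToHom h') = Arrow.mk f := by
  subst h h'; simp

/-- The functor determined by its actions on objects and on arrows. -/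
def functorMk (o : D → E) (r : ∀ {a b : D}, (a ⟶ b) → Arrow E)
    (hl : ∀ {a b : D} (f : a ⟶ b), (r f).left = o a)
    (hr : ∀ {a b : D} (f : a ⟶ b), (r f).right = o b)
    (h_id : ∀ a : D, r (𝟙 a) = Arrow.mk (𝟙 (o a)))
    (h_comp : ∀ {a b c : D} (f : a ⟶ b) (g : b ⟶ c),
      r (f ≫ g) = (r f).compose (r g) ((hr f).trans (hl g).symm)) : D ⥤ E where
  obj := o
  map f := eqToHom (hl f).symm ≫ (r f).hom ≫ eqToHom (hr f)
  map_id a := mk_injective _ _ ((mk_eqToHom_conj _ _ _).trans (h_id a))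
  map_comp f g := mk_injective _ _ ((mk_eqToHom_conj _ _ _).trans ((h_comp f g).trans (by
    rw [compose]
    refine (mk_eqToHom_conj (hl f).symm _ (hr g)).symm.trans ?_
    simp)))

end CategoryTheory.Arrow

/-- A functor which is bijective on objects and on arrows is an isomorphism of categories. -/
lemma isIso_of_bijective_arrows {X Y : Cat.{u, u}} (F : X ⟶ Y)
    (h₀ : Function.Bijective F.toFunctor.obj)
    (h₁ : Function.Bijective F.toFunctor.mapArrow.obj) : IsIso F := by
  let e₀ := Equiv.ofBijective _ h₀
  let e₁ := Equiv.ofBijective _ h₁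
  have he₀ (y) : F.toFunctor.obj (e₀.symm y) = y := e₀.apply_symm_apply y
  have he₁ (y) : F.toFunctor.mapArrow.obj (e₁.symm y) = y := e₁.apply_symm_apply y
  have hl (f : Arrow Y) : (e₁.symm f).left = e₀.symm f.left :=
    h₀.1 ((congrArg Comma.left (he₁ f)).trans (he₀ _).symm)
  have hr (f : Arrow Y) : (e₁.symm f).right = e₀.symm f.right :=
    h₀.1 ((congrArg Comma.right (he₁ f)).trans (he₀ _).symm)
  -- Identities and composites are compared after applying `F`, which is injective on arrows.
  let G : Y ⥤ X := Arrow.functorMk e₀.symm (fun f ↦ e₁.symm (Arrow.mk f)) (fun f ↦ hl _)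
    (fun f ↦ hr _) (fun a ↦ h₁.1 ((he₁ _).trans (by
      have h : Arrow.mk (𝟙 a) = Arrow.mk (𝟙 (F.toFunctor.obj (e₀.symm a))) := by rw [he₀]
      rw [h]
      exact congrArg _ (F.toFunctor.map_id _).symm)))
    (fun f g ↦ h₁.1 ((he₁ _).trans (by
      rw [Arrow.map_compose, ← Arrow.mk_compose_mk]
      exact Arrow.compose_congr (he₁ _).symm (he₁ _).symm _)))
  have hG {a b : Y} (f : a ⟶ b) : Arrow.mk (G.map f) = e₁.symm (Arrow.mk f) :=
    Arrow.mk_eqToHom_conj _ _ _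
  refine ⟨G.toCatHom, Cat.ext ?_, Cat.ext ?_⟩
  · refine Arrow.functor_ext fun _ _ f ↦ ?_
    exact (hG _).trans (e₁.symm_apply_apply (Arrow.mk f))
  · refine Arrow.functor_ext fun _ _ f ↦ ?_
    refine Eq.trans ?_ (he₁ (Arrow.mk f))
    exact congrArg F.toFunctor.mapArrow.obj (hG f)

/-! ### The essential image of the nerve -/

namespace InternalCategory

variable {C : Type u} [Category.{v} C] {S : Type*} [Category* S] {ι : S ⥤ C}

/-- A presentation of the objects and arrows of a presheaf of categories `X` on `S` as the
`ι`-points of two objects of `C`. -/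
structure NervePresentation (ι : S ⥤ C) (X : Sᵒᵖ ⥤ Cat.{v, v}) where
  D₀ : C
  D₁ : C
  e₀ (n : S) : (ι.obj n ⟶ D₀) ≃ X.obj (op n)
  e₁ (n : S) : (ι.obj n ⟶ D₁) ≃ Arrow (X.obj (op n))
  e₀_map {m n : S} (a : m ⟶ n) (z : ι.obj n ⟶ D₀) :
    e₀ m (ι.map a ≫ z) = (X.map a.op).toFunctor.obj (e₀ n z)
  e₁_map {m n : S} (a : m ⟶ n) (z : ι.obj n ⟶ D₁) :
    e₁ m (ι.map a ≫ z) = (X.map a.op).toFunctor.mapArrow.obj (e₁ n z)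

namespace NervePresentation

variable {X : Sᵒᵖ ⥤ Cat.{v, v}} (P : NervePresentation ι X) [ι.IsPointDense]

/-- The source morphism. -/
def s : P.D₁ ⟶ P.D₀ := ι.homOfPoints (fun n z ↦ (P.e₀ n).symm (P.e₁ n z).left) (fun _ _ a z ↦ by
  rw [Equiv.symm_apply_eq, P.e₀_map, Equiv.apply_symm_apply, P.e₁_map]; rfl)

lemma e₀_s {n : S} (z : ι.obj n ⟶ P.D₁) : P.e₀ n (z ≫ P.s) = (P.e₁ n z).left := by
  rw [s, ι.comp_homOfPoints, Equiv.apply_symm_apply]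

/-- The target morphism. -/
def t : P.D₁ ⟶ P.D₀ := ι.homOfPoints (fun n z ↦ (P.e₀ n).symm (P.e₁ n z).right) (fun _ _ a z ↦ by
  rw [Equiv.symm_apply_eq, P.e₀_map, Equiv.apply_symm_apply, P.e₁_map]; rfl)

lemma e₀_t {n : S} (z : ι.obj n ⟶ P.D₁) : P.e₀ n (z ≫ P.t) = (P.e₁ n z).right := by
  rw [t, ι.comp_homOfPoints, Equiv.apply_symm_apply]

/-- The unit morphism. -/
def e : P.D₀ ⟶ P.D₁ := ι.homOfPoints (fun n z ↦ (P.e₁ n).symm (Arrow.mk (𝟙 (P.e₀ n z))))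
  (fun _ _ a z ↦ by
    rw [Equiv.symm_apply_eq, P.e₁_map, Equiv.apply_symm_apply, P.e₀_map]
    exact congrArg Arrow.mk ((X.map a.op).toFunctor.map_id _).symm)

lemma e₁_e {n : S} (z : ι.obj n ⟶ P.D₀) : P.e₁ n (z ≫ P.e) = Arrow.mk (𝟙 (P.e₀ n z)) := by
  rw [e, ι.comp_homOfPoints, Equiv.apply_symm_apply]

lemma hom_ext₀ {Y : C} {f g : Y ⟶ P.D₀}
    (h : ∀ (n : S) (z : ι.obj n ⟶ Y), P.e₀ n (z ≫ f) = P.e₀ n (z ≫ g)) : f = g :=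
  Functor.IsPointDense.hom_ext (ι := ι) fun n z ↦ (P.e₀ n).injective (h n z)

lemma hom_ext₁ {Y : C} {f g : Y ⟶ P.D₁}
    (h : ∀ (n : S) (z : ι.obj n ⟶ Y), P.e₁ n (z ≫ f) = P.e₁ n (z ≫ g)) : f = g :=
  Functor.IsPointDense.hom_ext (ι := ι) fun n z ↦ (P.e₁ n).injective (h n z)

lemma e_s : P.e ≫ P.s = 𝟙 _ := P.hom_ext₀ fun n z ↦ by
  rw [← Category.assoc, e₀_s, e₁_e, Category.comp_id]; rfl

lemma e_t : P.e ≫ P.t = 𝟙 _ := P.hom_ext₀ fun n z ↦ by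
  rw [← Category.assoc, e₀_t, e₁_e, Category.comp_id]; rfl

lemma composable {n : S} {z w : ι.obj n ⟶ P.D₁} (h : z ≫ P.t = w ≫ P.s) :
    (P.e₁ n z).right = (P.e₁ n w).left := by
  rw [← e₀_t, ← e₀_s, h]

variable [HasFiniteLimits C]

lemma composable_fst_snd {n : S} (z : ι.obj n ⟶ pullback P.t P.s) :
    (z ≫ pullback.fst _ _) ≫ P.t = (z ≫ pullback.snd _ _) ≫ P.s := by
  rw [Category.assoc, Category.assoc, pullback.condition]

/-- The composition. -/
def m : pullback P.t P.s ⟶ P.D₁ :=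
  ι.homOfPoints (fun n z ↦ (P.e₁ n).symm ((P.e₁ n (z ≫ pullback.fst _ _)).compose
    (P.e₁ n (z ≫ pullback.snd _ _)) (P.composable (P.composable_fst_snd z)))) (fun _ _ a z ↦ by
    rw [Equiv.symm_apply_eq, P.e₁_map, Equiv.apply_symm_apply, Arrow.map_compose]
    exact Arrow.compose_congr (by rw [Category.assoc, P.e₁_map])
      (by rw [Category.assoc, P.e₁_map]) _)

lemma e₁_m {n : S} (z : ι.obj n ⟶ pullback P.t P.s) :
    P.e₁ n (z ≫ P.m) = (P.e₁ n (z ≫ pullback.fst _ _)).compose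
      (P.e₁ n (z ≫ pullback.snd _ _)) (P.composable (P.composable_fst_snd z)) := by
  rw [m, ι.comp_homOfPoints, Equiv.apply_symm_apply]

lemma e₁_lift_m {Y : C} (f g : Y ⟶ P.D₁) (h : f ≫ P.t = g ≫ P.s) {n : S} (z : ι.obj n ⟶ Y) :
    P.e₁ n (z ≫ pullback.lift f g h ≫ P.m) = (P.e₁ n (z ≫ f)).compose (P.e₁ n (z ≫ g))
      (P.composable (by rw [Category.assoc, Category.assoc, h])) := by
  rw [← Category.assoc, e₁_m]
  exact Arrow.compose_congr (by rw [Category.assoc, pullback.lift_fst])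
    (by rw [Category.assoc, pullback.lift_snd]) _

lemma m_s : P.m ≫ P.s = pullback.fst P.t P.s ≫ P.s := P.hom_ext₀ fun n z ↦ by
  rw [← Category.assoc, e₀_s, e₁_m, ← Category.assoc, e₀_s]; rfl

lemma m_t : P.m ≫ P.t = pullback.snd P.t P.s ≫ P.t := P.hom_ext₀ fun n z ↦ by
  rw [← Category.assoc, e₀_t, e₁_m, ← Category.assoc, e₀_t]; rfl

/-- The internal category whose nerve is presented by `P`. -/
def internalCategory : InternalCategory C where
  A₀ := P.D₀
  A₁ := P.D₁
  s := P.s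
  t := P.t
  e := P.e
  m := P.m
  e_s := P.e_s
  e_t := P.e_t
  m_s := P.m_s
  m_t := P.m_t
  e_m := P.hom_ext₁ fun n z ↦ by
    rw [e₁_lift_m]
    refine (Arrow.compose_congr ?_ ?_ _).trans (Arrow.id_compose _)
    · rw [← Category.assoc, e₁_e, e₀_s, Category.comp_id]
    · rfl
  m_e := P.hom_ext₁ fun n z ↦ by
    rw [e₁_lift_m]
    refine (Arrow.compose_congr ?_ ?_ _).trans (Arrow.compose_id _)
    · rfl
    · rw [← Category.assoc, e₁_e, e₀_t, Category.comp_id]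
  assoc f g h w₁ w₂ := P.hom_ext₁ fun n z ↦ by
    refine (P.e₁_lift_m _ _ _ _).trans (Eq.trans ?_ (P.e₁_lift_m _ _ _ _).symm)
    exact (Arrow.compose_congr (P.e₁_lift_m _ _ _ _) rfl _).trans
      ((Arrow.compose_assoc _ _ _ _ _).trans
        (Arrow.compose_congr rfl (P.e₁_lift_m _ _ _ _).symm _))

/-- The comparison functor from the nerve of the presented internal category. -/
def comparison (n : S) : Points P.internalCategory (ι.obj n) ⥤ X.obj (op n) :=
  Arrow.functorMk (fun a ↦ P.e₀ n a.pt) (fun f ↦ P.e₁ n f.1)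
    (fun f ↦ (P.e₀_s _).symm.trans (congrArg _ f.2.1))
    (fun f ↦ (P.e₀_t _).symm.trans (congrArg _ f.2.2))
    (fun a ↦ P.e₁_e a.pt)
    (fun f g ↦ by
      refine (congrArg (P.e₁ n) (Category.id_comp _).symm).trans
        ((P.e₁_lift_m f.1 g.1 (f.2.2.trans g.2.1.symm) (𝟙 _)).trans ?_)
      exact Arrow.compose_congr (congrArg (P.e₁ n) (Category.id_comp _))
        (congrArg (P.e₁ n) (Category.id_comp _)) _)

lemma mk_comparison_map {n : S} {a b : Points P.internalCategory (ι.obj n)} (f : a ⟶ b) :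
    Arrow.mk ((P.comparison n).map f) = P.e₁ n f.1 :=
  Arrow.mk_eqToHom_conj _ _ _

/-- The presentation is bijective on objects and on arrows by hypothesis; a morphism of points, with
its endpoints, is just a point of the object of morphisms. -/
lemma isIso_comparison (n : S) : IsIso (P.comparison n).toCatHom := by
  apply isIso_of_bijective_arrows
  · constructor
    · intro a b h
      exact Points.ext ((P.e₀ n).injective h)
    · intro y
      exact ⟨⟨(P.e₀ n).symm y⟩, (P.e₀ n).apply_symm_apply y⟩
  · constructor
    · rintro ⟨⟨a⟩, ⟨b⟩, f⟩ ⟨⟨a'⟩, ⟨b'⟩, g⟩ h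
      have h' : P.e₁ n f.1 = P.e₁ n g.1 :=
        (P.mk_comparison_map f).symm.trans (h.trans (P.mk_comparison_map g))
      replace h' := (P.e₁ n).injective h'
      obtain ⟨f, hf⟩ := f
      obtain ⟨g, hg⟩ := g
      obtain rfl : f = g := h'
      obtain rfl : a = a' := hf.1.symm.trans hg.1
      obtain rfl : b = b' := hf.2.symm.trans hg.2
      rfl
    · intro y
      exact ⟨Arrow.mk (P.internalCategory.homMk ((P.e₁ n).symm y)),
        (P.mk_comparison_map _).trans ((P.e₁ n).apply_symm_apply y)⟩

/-- A presheaf of categories with a presentation is isomorphic to the nerve of the presented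
internal category. -/
def nerveIso : (pointsNerve ι).obj P.internalCategory ≅ X :=
  NatIso.ofComponents
    (fun n ↦ @asIso _ _ _ _ (P.comparison n.unop).toCatHom (P.isIso_comparison n.unop))
    (fun {m n} a ↦ by
    refine Cat.ext (Arrow.functor_ext fun _ _ f ↦ ?_)
    refine (P.mk_comparison_map ((Points.precomp P.internalCategory (ι.map a.unop)).map f)).trans
      ((P.e₁_map a.unop f.1).trans ?_)
    exact congrArg (X.map a).toFunctor.mapArrow.obj (P.mk_comparison_map f).symm)

end NervePresentation

end InternalCategory

/-! ### Weak equivalences and fibrations on points -/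

namespace InternalCategory

variable {C : Type u} [Category.{v} C] [HasFiniteLimits C]

attribute [local simp] pullback.lift_fst pullback.lift_fst_assoc pullback.lift_snd
  pullback.lift_snd_assoc prod.lift_fst prod.lift_fst_assoc prod.lift_snd prod.lift_snd_assoc

section Isos

variable {A B : InternalCategory C} {X : C}

lemma eqToHom_comp_val {a b c : Points B X} (h : a = b) (f : b ⟶ c) :
    (eqToHom h ≫ f).1 = f.1 := by
  subst h; simp

/-- An isomorphism of points given by a point of the object of isomorphisms. -/
def pointsIso (z : X ⟶ B.iso₁) {a b : Points B X} (ha : z ≫ B.isoHom ≫ B.s = a.pt)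
    (hb : z ≫ B.isoHom ≫ B.t = b.pt) : a ≅ b where
  hom := ⟨z ≫ B.isoHom, by rw [Category.assoc, ha], by rw [Category.assoc, hb]⟩
  inv := ⟨z ≫ B.isoInv, by rw [Category.assoc, B.isoInv_s, hb],
    by rw [Category.assoc, B.isoInv_t, ha]⟩
  hom_inv_id := Points.hom_ext ((B.precomp_comp _ _ _ _).symm.trans (by
    rw [isoHom_comp_isoInv, Points.id_val, ← ha, Category.assoc, Category.assoc]))
  inv_hom_id := Points.hom_ext ((B.precomp_comp _ _ _ _).symm.trans (by
    rw [isoInv_comp_isoHom, Points.id_val, ← hb, Category.assoc, Category.assoc]))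

/-- The point of the object of isomorphisms given by an isomorphism of points. -/
def isoPoint {a b : Points B X} (e : a ≅ b) : X ⟶ B.iso₁ :=
  B.isoLift e.hom.1 e.inv.1 (e.hom.2.2.trans e.inv.2.1.symm) (e.inv.2.2.trans e.hom.2.1.symm)
    ((congrArg Subtype.val e.hom_inv_id).trans (by
      rw [Points.id_val, ← Category.assoc, e.hom.2.1]))
    ((congrArg Subtype.val e.inv_hom_id).trans (by
      rw [Points.id_val, ← Category.assoc, e.hom.2.2]))

lemma isoPoint_isoHom {a b : Points B X} (e : a ≅ b) : isoPoint e ≫ B.isoHom = e.hom.1 :=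
  isoLift_isoHom _ _ _ _ _ _ _

lemma isoPoint_isoHom_s {a b : Points B X} (e : a ≅ b) :
    isoPoint e ≫ B.isoHom ≫ B.s = a.pt := by
  rw [← Category.assoc, isoPoint_isoHom, e.hom.2.1]

lemma isoPoint_isoHom_t {a b : Points B X} (e : a ≅ b) :
    isoPoint e ≫ B.isoHom ≫ B.t = b.pt := by
  rw [← Category.assoc, isoPoint_isoHom, e.hom.2.2]

/-- Inverses are unique in the category of points, so an isomorphism is determined by its forward
morphism. -/
instance : Mono B.isoHom where
  right_cancellation {X} z w h := by
    let a : Points B X := ⟨z ≫ B.isoHom ≫ B.s⟩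
    let b : Points B X := ⟨z ≫ B.isoHom ≫ B.t⟩
    let e : a ≅ b := pointsIso z rfl rfl
    let e' : a ≅ b := pointsIso w (by rw [← Category.assoc, ← h, Category.assoc])
      (by rw [← Category.assoc, ← h, Category.assoc])
    have he : e = e' := Iso.ext (Points.hom_ext h)
    have h' : z ≫ B.isoInv = w ≫ B.isoInv := congrArg (fun i : a ≅ b ↦ i.inv.1) he
    refine equalizer.hom_ext (pullback.hom_ext ?_ ?_)
    · simpa [isoHom] using h
    · simpa [isoInv] using h'

lemma isoMap_isoHom (F : A ⟶ B) : isoMap F ≫ B.isoHom = A.isoHom ≫ F.F₁ :=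
  isoLift_isoHom _ _ _ _ _ _ _

lemma pathComparison_fst (F : A ⟶ B) :
    pathComparison F ≫ pullback.fst F.F₀ (B.isoHom ≫ B.t) = A.isoHom ≫ A.t :=
  pullback.lift_fst _ _ _

lemma pathComparison_snd (F : A ⟶ B) :
    pathComparison F ≫ pullback.snd F.F₀ (B.isoHom ≫ B.t) = isoMap F :=
  pullback.lift_snd _ _ _

/-- The point of the mapping path object given by an isomorphism `b ≅ F a` of points. -/
def pathPoint (F : A ⟶ B) {a : Points A X} {b : Points B X}
    (e : b ≅ (Points.postcomp F X).obj a) : X ⟶ pathObj F :=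
  pullback.lift a.pt (isoPoint e) (by rw [isoPoint_isoHom_t]; rfl)

lemma pathPoint_fst (F : A ⟶ B) {a : Points A X} {b : Points B X}
    (e : b ≅ (Points.postcomp F X).obj a) : pathPoint F e ≫ pullback.fst _ _ = a.pt :=
  pullback.lift_fst _ _ _

lemma pathPoint_snd (F : A ⟶ B) {a : Points A X} {b : Points B X}
    (e : b ≅ (Points.postcomp F X).obj a) : pathPoint F e ≫ pullback.snd _ _ = isoPoint e :=
  pullback.lift_snd _ _ _

lemma pathPoint_pathSource (F : A ⟶ B) {a : Points A X} {b : Points B X}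
    (e : b ≅ (Points.postcomp F X).obj a) : pathPoint F e ≫ pathSource F = b.pt := by
  rw [pathSource, ← Category.assoc, pathPoint_snd, isoPoint_isoHom_s]

/-- The isomorphism `b ≅ F a` given by a point of the mapping path object. -/
def pathIso (F : A ⟶ B) (z : X ⟶ pathObj F) :
    (⟨z ≫ pathSource F⟩ : Points B X) ≅
      (Points.postcomp F X).obj ⟨z ≫ pullback.fst _ _⟩ :=
  pointsIso (z ≫ pullback.snd _ _) (by rw [Category.assoc, pathSource])
    (by rw [Category.assoc, ← pullback.condition]; exact (Category.assoc _ _ _).symm)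

/-- A point of `pathObj F` is an object `a` with an isomorphism `b ≅ F a`, and `pathSource F` reads
off `b`. -/
lemma essSurj_postcomp_iff (F : A ⟶ B) (X : C) : (Points.postcomp F X).EssSurj ↔
    ∀ b : X ⟶ B.A₀, ∃ z : X ⟶ pathObj F, z ≫ pathSource F = b := by
  constructor
  · intro h b
    obtain ⟨a, ⟨e⟩⟩ := h.mem_essImage ⟨b⟩
    exact ⟨pathPoint F e.symm, pathPoint_pathSource F e.symm⟩
  · intro h
    refine ⟨fun b ↦ ?_⟩
    obtain ⟨z, hz⟩ := h b.pt
    exact ⟨_, ⟨(pathIso F z).symm ≪≫ eqToIso (Points.ext hz)⟩⟩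

/-- A point of `pathObj F` is the datum `b ≅ F a` of an isomorphism to be lifted, and a preimage in
`iso₁` is a lift of it ending at `a`. -/
lemma isIsofibration_postcomp_iff (F : A ⟶ B) (X : C) :
    IsIsofibration (Points.postcomp F X) ↔
      ∀ z : X ⟶ pathObj F, ∃ w : X ⟶ A.iso₁, w ≫ pathComparison F = z := by
  constructor
  · intro h z
    obtain ⟨a', f, h₀, h₁⟩ := h _ _ (pathIso F z)
    refine ⟨isoPoint f, pullback.hom_ext ?_ ?_⟩
    · rw [Category.assoc, pathComparison_fst]
      exact isoPoint_isoHom_t f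
    · rw [Category.assoc, pathComparison_snd, ← cancel_mono B.isoHom, Category.assoc,
        isoMap_isoHom, ← Category.assoc, isoPoint_isoHom]
      exact (congrArg Subtype.val h₁).trans (eqToHom_comp_val _ _)
  · intro h a b g
    obtain ⟨w, hw⟩ := h (pathPoint F g)
    have h₁ : w ≫ A.isoHom ≫ A.t = a.pt := by
      rw [← pathComparison_fst F, ← Category.assoc, hw, pathPoint_fst]
    have h₂ : w ≫ A.isoHom ≫ F.F₁ = g.hom.1 := by
      rw [← isoMap_isoHom F, ← pathComparison_snd, ← Category.assoc, ← Category.assoc, hw,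
        pathPoint_snd, isoPoint_isoHom]
    have h₃ : (w ≫ A.isoHom ≫ A.s) ≫ F.F₀ = b.pt := by
      rw [← g.hom.2.1, ← h₂]
      simp only [Category.assoc, F.map_s]
    refine ⟨⟨w ≫ A.isoHom ≫ A.s⟩, pointsIso w rfl h₁, Points.ext h₃, Points.hom_ext ?_⟩
    exact ((Category.assoc _ _ _).trans h₂).trans (eqToHom_comp_val _ _).symm

end Isos

section FullyFaithful

variable {A B : InternalCategory C} {F : A ⟶ B}

lemma fullyFaithful_w (F : A ⟶ B) :
    F.F₁ ≫ prod.lift B.s B.t = prod.lift A.s A.t ≫ prod.map F.F₀ F.F₀ := by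
  ext <;> simp [F.map_s, F.map_t]

lemma fullyFaithful.faithful (h : fullyFaithful F) (X : C) : (Points.postcomp F X).Faithful where
  map_injective {a b f g} hfg := Points.hom_ext (IsPullback.hom_ext h (congrArg Subtype.val hfg) (by
    ext
    · simpa using f.2.1.trans g.2.1.symm
    · simpa using f.2.2.trans g.2.2.symm))

lemma fullyFaithful.full (h : fullyFaithful F) (X : C) : (Points.postcomp F X).Full where
  map_surjective {a b} g := by
    have hg : g.1 ≫ prod.lift B.s B.t = prod.lift a.pt b.pt ≫ prod.map F.F₀ F.F₀ := by
      ext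
      · simpa [Points.postcomp] using g.2.1
      · simpa [Points.postcomp] using g.2.2
    have h₁ := IsPullback.lift_snd h _ _ hg
    refine ⟨⟨IsPullback.lift h g.1 (prod.lift a.pt b.pt) hg, ?_, ?_⟩,
      Points.hom_ext (IsPullback.lift_fst h _ _ _)⟩
    · simpa using h₁ =≫ prod.fst
    · simpa using h₁ =≫ prod.snd

variable {S : Type*} [Category* S] (ι : S ⥤ C)

/-- Full faithfulness on points says that the comparison of `A₁` with the pullback is bijective on
`ι`-points; density turns this into an isomorphism. -/
lemma fullyFaithful_of_points [ι.IsPointDense] (h : ∀ n, (Points.postcomp F (ι.obj n)).Full)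
    (h' : ∀ n, (Points.postcomp F (ι.obj n)).Faithful) : fullyFaithful F := by
  let p : A.A₁ ⟶ pullback (prod.lift B.s B.t) (prod.map F.F₀ F.F₀) :=
    pullback.lift F.F₁ (prod.lift A.s A.t) (fullyFaithful_w F)
  have hp₁ : p ≫ pullback.fst _ _ = F.F₁ := pullback.lift_fst _ _ _
  have hp₂ : p ≫ pullback.snd _ _ = prod.lift A.s A.t := pullback.lift_snd _ _ _
  have : IsIso p := by
    refine ι.isIso_of_bijective_points _ fun n ↦ ⟨fun f g hfg ↦ ?_, fun z ↦ ?_⟩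
    · have h₁ : f ≫ F.F₁ = g ≫ F.F₁ := by
        simpa only [Category.assoc, hp₁] using hfg =≫ pullback.fst _ _
      have h₂ : f ≫ prod.lift A.s A.t = g ≫ prod.lift A.s A.t := by
        simpa only [Category.assoc, hp₂] using hfg =≫ pullback.snd _ _
      have h₃ : f ≫ A.s = g ≫ A.s := by simpa using h₂ =≫ prod.fst
      have h₄ : f ≫ A.t = g ≫ A.t := by simpa using h₂ =≫ prod.snd
      let f' : (⟨f ≫ A.s⟩ : Points A (ι.obj n)) ⟶ ⟨f ≫ A.t⟩ := ⟨f, rfl, rfl⟩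
      let g' : (⟨f ≫ A.s⟩ : Points A (ι.obj n)) ⟶ ⟨f ≫ A.t⟩ := ⟨g, h₃.symm, h₄.symm⟩
      have := h' n
      have h₅ : f' = g' := (Points.postcomp F (ι.obj n)).map_injective (Points.hom_ext h₁)
      exact congrArg Subtype.val h₅
    · have hz := z ≫= pullback.condition (f := prod.lift B.s B.t) (g := prod.map F.F₀ F.F₀)
      let a : Points A (ι.obj n) := ⟨z ≫ pullback.snd _ _ ≫ prod.fst⟩
      let b : Points A (ι.obj n) := ⟨z ≫ pullback.snd _ _ ≫ prod.snd⟩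
      let g : (Points.postcomp F (ι.obj n)).obj a ⟶ (Points.postcomp F (ι.obj n)).obj b :=
        ⟨z ≫ pullback.fst _ _, by simpa [Points.postcomp, a] using hz =≫ prod.fst,
          by simpa [Points.postcomp, b] using hz =≫ prod.snd⟩
      have := h n
      obtain ⟨f, hf⟩ := (Points.postcomp F (ι.obj n)).map_surjective g
      refine ⟨f.1, pullback.hom_ext ?_ ?_⟩
      · simp only [Category.assoc, hp₁]
        exact congrArg Subtype.val hf
      · simp only [Category.assoc, hp₂]
        ext
        · simpa using f.2.1
        · simpa using f.2.2
  exact IsPullback.of_iso_pullback ⟨fullyFaithful_w F⟩ (asIso p) hp₁ hp₂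

end FullyFaithful

section Classes

variable {S : Type*} [Category* S] (ι : S ⥤ C)

/-- A morphism is surjective on `ι`-points. -/
def pointSurjective : MorphismProperty C := fun _ Y p ↦
  ∀ (n : S) (y : ι.obj n ⟶ Y), ∃ x, x ≫ p = y

/-- The internal functors inducing equivalences of categories of `ι`-points. -/
def nerveEquivalences : MorphismProperty (InternalCategory C) :=
  (catEquivalences.functorCategory Sᵒᵖ).inverseImage (pointsNerve ι)

/-- The internal functors inducing isofibrations between categories of `ι`-points. -/
def nerveFibrations : MorphismProperty (InternalCategory C) :=
  (isofibrations.functorCategory Sᵒᵖ).inverseImage (pointsNerve ι)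

variable {A B : InternalCategory C} (F : A ⟶ B)

lemma nerveFibrations_iff : nerveFibrations ι F ↔ pointSurjective ι (pathComparison F) :=
  ⟨fun h n ↦ (isIsofibration_postcomp_iff F (ι.obj n)).1 (h (op n)),
    fun h n ↦ (isIsofibration_postcomp_iff F (ι.obj n.unop)).2 (h n.unop)⟩

/-- Density enters only in deducing the pullback condition in `C` from full faithfulness on
`ι`-points; the converse holds for points of any shape. -/
lemma nerveEquivalences_iff [ι.IsPointDense] :
    nerveEquivalences ι F ↔ fullyFaithful F ∧ pointSurjective ι (pathSource F) := by
  constructor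
  · intro h
    have h' (n : S) : (Points.postcomp F (ι.obj n)).IsEquivalence := h (op n)
    exact ⟨fullyFaithful_of_points ι (fun n ↦ (h' n).full) (fun n ↦ (h' n).faithful),
      fun n ↦ (essSurj_postcomp_iff F (ι.obj n)).1 (h' n).essSurj⟩
  · rintro ⟨h₁, h₂⟩ n
    exact { faithful := h₁.faithful _
            full := h₁.full _
            essSurj := (essSurj_postcomp_iff F (ι.obj n.unop)).2 (h₂ n.unop) }

/-- Essential surjectivity gives `b ≅ F a`, and the isofibration property replaces `a` by an object
lying strictly over `b`. Conversely an object is lifted strictly, and the isomorphism then lifts by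
full faithfulness. Acyclicity thereby becomes a condition on `F₀` beside full faithfulness. -/
lemma nerve_acyclicFibrations_iff [ι.IsPointDense] :
    (nerveFibrations ι ⊓ nerveEquivalences ι) F ↔ fullyFaithful F ∧ pointSurjective ι F.F₀ := by
  constructor
  · rintro ⟨h₁, h₂⟩
    refine ⟨((nerveEquivalences_iff ι F).1 h₂).1, fun n b ↦ ?_⟩
    have : (Points.postcomp F (ι.obj n)).IsEquivalence := h₂ (op n)
    have h₃ : IsIsofibration (Points.postcomp F (ι.obj n)) := h₁ (op n)
    obtain ⟨a, ⟨e⟩⟩ := this.essSurj.mem_essImage ⟨b⟩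
    obtain ⟨a', _, h, _⟩ := h₃ a ⟨b⟩ e.symm
    exact ⟨a'.pt, congrArg Points.pt h⟩
  · rintro ⟨h₁, h₂⟩
    constructor
    · intro n a b g
      have := h₁.full (ι.obj n.unop)
      have := h₁.faithful (ι.obj n.unop)
      obtain ⟨a', ha'⟩ := h₂ n.unop (Points.pt b)
      let a₀ : Points A (ι.obj n.unop) := ⟨a'⟩
      have h₀ : (Points.postcomp F (ι.obj n.unop)).obj a₀ = b := Points.ext ha'
      refine ⟨a₀, (Points.postcomp F (ι.obj n.unop)).preimageIso (eqToIso h₀ ≪≫ g), h₀, ?_⟩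
      exact (Points.postcomp F (ι.obj n.unop)).map_preimage _
    · intro n
      exact { faithful := h₁.faithful _
              full := h₁.full _
              essSurj := ⟨fun b ↦ by
                obtain ⟨a', ha'⟩ := h₂ n.unop (Points.pt b)
                exact ⟨(⟨a'⟩ : Points A (ι.obj n.unop)), ⟨eqToIso (Points.ext ha')⟩⟩⟩ }

end Classes

end InternalCategory

namespace InternalCategory

variable {C : Type u} [Category.{v} C] [HasFiniteLimits C]

attribute [local simp] pullback.lift_fst pullback.lift_fst_assoc pullback.lift_snd
  pullback.lift_snd_assoc prod.lift_fst prod.lift_fst_assoc prod.lift_snd prod.lift_snd_assoc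

/-! ### Lifting along fully faithful internal functors -/

namespace fullyFaithful

variable {A B : InternalCategory C} {F : A ⟶ B} (hF : fullyFaithful F)

include hF

lemma hom_ext₁ {X : C} {f g : X ⟶ A.A₁} (h : f ≫ F.F₁ = g ≫ F.F₁) (hs : f ≫ A.s = g ≫ A.s)
    (ht : f ≫ A.t = g ≫ A.t) : f = g :=
  IsPullback.hom_ext hF h (by ext <;> simp [hs, ht])

lemma exists_lift₁ {X : C} (f : X ⟶ B.A₁) (a b : X ⟶ A.A₀) (ha : f ≫ B.s = a ≫ F.F₀)
    (hb : f ≫ B.t = b ≫ F.F₀) :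
    ∃ g : X ⟶ A.A₁, g ≫ F.F₁ = f ∧ g ≫ A.s = a ∧ g ≫ A.t = b := by
  have w : f ≫ prod.lift B.s B.t = prod.lift a b ≫ prod.map F.F₀ F.F₀ := by
    ext <;> simp [ha, hb]
  have h₁ := IsPullback.lift_snd hF _ _ w
  exact ⟨IsPullback.lift hF f (prod.lift a b) w, IsPullback.lift_fst hF _ _ _,
    by simpa using h₁ =≫ prod.fst, by simpa using h₁ =≫ prod.snd⟩

/-- The pullback property supplies the action on morphisms once the objects are lifted. With the
uniqueness in `hom_ext`, lifting problems against fully faithful functors reduce to problems about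
objects. -/
lemma exists_lift {D : InternalCategory C} (G : D ⟶ B) (g : D.A₀ ⟶ A.A₀) (hg : g ≫ F.F₀ = G.F₀) :
    ∃ G' : D ⟶ A, G' ≫ F = G ∧ G'.F₀ = g := by
  obtain ⟨k, h₁, h₂, h₃⟩ := hF.exists_lift₁ G.F₁ (D.s ≫ g) (D.t ≫ g)
    (by rw [G.map_s, Category.assoc, hg]) (by rw [G.map_t, Category.assoc, hg])
  have hm : (pullback.fst D.t D.s ≫ k) ≫ A.t = (pullback.snd D.t D.s ≫ k) ≫ A.s := by
    rw [Category.assoc, Category.assoc, h₂, h₃, pullback.condition_assoc]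
  -- Compatibility with units and with composition are equalities of maps into the pullback `A₁`,
  -- each tested on its image in `B₁`, its source and its target.
  refine ⟨⟨g, k, h₂, h₃, hF.hom_ext₁ ?_ ?_ ?_, hF.hom_ext₁ ?_ ?_ ?_⟩, hom_ext hg h₁, rfl⟩
  · rw [Category.assoc, Category.assoc, h₁, F.map_e, G.map_e, reassoc_of% hg]
  · simp only [Category.assoc, h₂, A.e_s, Category.comp_id]
    rw [reassoc_of% D.e_s]
  · simp only [Category.assoc, h₃, A.e_t, Category.comp_id]
    rw [reassoc_of% D.e_t]
  · rw [Category.assoc, h₁, G.map_m]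
    refine Eq.trans ?_ (F.comp_F₁ _ _ hm).symm
    exact B.comp_congr (by rw [Category.assoc, h₁]) (by rw [Category.assoc, h₁]) _
  · refine Eq.trans ?_ (A.comp_s _ _ hm).symm
    rw [Category.assoc, Category.assoc, h₂, reassoc_of% D.m_s]
  · refine Eq.trans ?_ (A.comp_t _ _ hm).symm
    rw [Category.assoc, Category.assoc, h₃, reassoc_of% D.m_t]

lemma hom_ext {D : InternalCategory C} {G G' : D ⟶ A} (h : G ≫ F = G' ≫ F)
    (h₀ : G.F₀ = G'.F₀) : G = G' :=
  InternalCategory.hom_ext h₀ (hF.hom_ext₁ (congrArg Hom.F₁ h)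
    (by rw [G.map_s, G'.map_s, h₀]) (by rw [G.map_t, G'.map_t, h₀]))

end fullyFaithful

/-! ### The full internal category on an object over the object of objects -/

section Induced

variable (B : InternalCategory C) {X : C} (p : X ⟶ B.A₀)

/-- The object of morphisms of `B` between objects in the image of `p`. -/
def inducedA₁ : C := pullback (prod.lift B.s B.t) (prod.map p p)

/-- The underlying morphism of `B`. -/
def inducedHom : B.inducedA₁ p ⟶ B.A₁ := pullback.fst _ _

/-- The source, as a point of `X`. -/
def inducedS : B.inducedA₁ p ⟶ X := pullback.snd _ _ ≫ prod.fst

/-- The target, as a point of `X`. -/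
def inducedT : B.inducedA₁ p ⟶ X := pullback.snd _ _ ≫ prod.snd

lemma inducedHom_s : B.inducedHom p ≫ B.s = B.inducedS p ≫ p := by
  have h := (pullback.condition (f := prod.lift B.s B.t) (g := prod.map p p)) =≫ prod.fst
  simp only [Category.assoc, prod.lift_fst, prod.map_fst] at h
  exact h.trans (Category.assoc _ _ _).symm

lemma inducedHom_t : B.inducedHom p ≫ B.t = B.inducedT p ≫ p := by
  have h := (pullback.condition (f := prod.lift B.s B.t) (g := prod.map p p)) =≫ prod.snd
  simp only [Category.assoc, prod.lift_snd, prod.map_snd] at h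
  exact h.trans (Category.assoc _ _ _).symm

variable {B p}

lemma induced_ext {Y : C} {f g : Y ⟶ B.inducedA₁ p}
    (h : f ≫ B.inducedHom p = g ≫ B.inducedHom p) (hs : f ≫ B.inducedS p = g ≫ B.inducedS p)
    (ht : f ≫ B.inducedT p = g ≫ B.inducedT p) : f = g :=
  pullback.hom_ext h (Limits.prod.hom_ext
    ((Category.assoc _ _ _).trans (hs.trans (Category.assoc _ _ _).symm))
    ((Category.assoc _ _ _).trans (ht.trans (Category.assoc _ _ _).symm)))

/-- A point of the object of morphisms between objects in the image of `p`. -/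
def inducedMk {Y : C} (f : Y ⟶ B.A₁) (a b : Y ⟶ X) (ha : f ≫ B.s = a ≫ p)
    (hb : f ≫ B.t = b ≫ p) : Y ⟶ B.inducedA₁ p :=
  pullback.lift f (prod.lift a b) (by ext <;> simp [ha, hb])

section

variable {Y : C} (f : Y ⟶ B.A₁) (a b : Y ⟶ X) (ha : f ≫ B.s = a ≫ p) (hb : f ≫ B.t = b ≫ p)

@[simp]
lemma inducedMk_hom : inducedMk f a b ha hb ≫ B.inducedHom p = f :=
  pullback.lift_fst _ _ _

@[simp]
lemma inducedMk_s : inducedMk f a b ha hb ≫ B.inducedS p = a :=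
  (pullback.lift_snd_assoc _ _ _ _).trans (prod.lift_fst _ _)

@[simp]
lemma inducedMk_t : inducedMk f a b ha hb ≫ B.inducedT p = b :=
  (pullback.lift_snd_assoc _ _ _ _).trans (prod.lift_snd _ _)

lemma comp_inducedMk {Z : C} (z : Z ⟶ Y) : z ≫ inducedMk f a b ha hb =
    inducedMk (z ≫ f) (z ≫ a) (z ≫ b) (by rw [Category.assoc, ha, Category.assoc])
      (by rw [Category.assoc, hb, Category.assoc]) := by
  apply induced_ext <;> simp

end

lemma induced_composable {Y : C} {f g : Y ⟶ B.inducedA₁ p}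
    (h : f ≫ B.inducedT p = g ≫ B.inducedS p) :
    (f ≫ B.inducedHom p) ≫ B.t = (g ≫ B.inducedHom p) ≫ B.s := by
  rw [Category.assoc, Category.assoc, inducedHom_s, inducedHom_t, reassoc_of% h]

/-- The composite of two composable points. -/
def inducedComp {Y : C} (f g : Y ⟶ B.inducedA₁ p) (h : f ≫ B.inducedT p = g ≫ B.inducedS p) :
    Y ⟶ B.inducedA₁ p :=
  inducedMk (B.comp (f ≫ B.inducedHom p) (g ≫ B.inducedHom p) (induced_composable h))
    (f ≫ B.inducedS p) (g ≫ B.inducedT p)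
    (by rw [comp_s, Category.assoc, Category.assoc, inducedHom_s])
    (by rw [comp_t, Category.assoc, Category.assoc, inducedHom_t])

section

variable {Y : C} (f g : Y ⟶ B.inducedA₁ p) (h : f ≫ B.inducedT p = g ≫ B.inducedS p)

@[simp]
lemma inducedComp_hom : inducedComp f g h ≫ B.inducedHom p =
    B.comp (f ≫ B.inducedHom p) (g ≫ B.inducedHom p) (induced_composable h) :=
  inducedMk_hom _ _ _ _ _

@[simp]
lemma inducedComp_s : inducedComp f g h ≫ B.inducedS p = f ≫ B.inducedS p :=
  inducedMk_s _ _ _ _ _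

@[simp]
lemma inducedComp_t : inducedComp f g h ≫ B.inducedT p = g ≫ B.inducedT p :=
  inducedMk_t _ _ _ _ _

end

lemma inducedComp_congr {Y : C} {f g f' g' : Y ⟶ B.inducedA₁ p} (hf : f = f') (hg : g = g')
    (h : f ≫ B.inducedT p = g ≫ B.inducedS p) :
    inducedComp f g h = inducedComp f' g' (by rw [← hf, ← hg, h]) := by
  subst hf hg; rfl

lemma inducedComp_assoc {Y : C} (f g h : Y ⟶ B.inducedA₁ p)
    (w₁ : f ≫ B.inducedT p = g ≫ B.inducedS p) (w₂ : g ≫ B.inducedT p = h ≫ B.inducedS p) :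
    inducedComp (inducedComp f g w₁) h (by rw [inducedComp_t, w₂]) =
      inducedComp f (inducedComp g h w₂) (by rw [inducedComp_s, w₁]) := by
  apply induced_ext
  · refine (inducedComp_hom _ _ _).trans (Eq.trans ?_ (inducedComp_hom _ _ _).symm)
    refine (B.comp_congr ?_ rfl _).trans ((B.comp_assoc (f ≫ B.inducedHom p)
      (g ≫ B.inducedHom p) (h ≫ B.inducedHom p) (induced_composable w₁)
      (induced_composable w₂)).trans (B.comp_congr rfl ?_ _))
    · rw [inducedComp_hom]
    · rw [inducedComp_hom]
  · rw [inducedComp_s, inducedComp_s, inducedComp_s]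
  · rw [inducedComp_t, inducedComp_t, inducedComp_t]

variable (B p) in
/-- The unit of the full internal category on `p`. -/
def inducedE : X ⟶ B.inducedA₁ p :=
  inducedMk (p ≫ B.e) (𝟙 X) (𝟙 X) (by simp [B.e_s]) (by simp [B.e_t])

@[simp]
lemma inducedE_hom : B.inducedE p ≫ B.inducedHom p = p ≫ B.e := inducedMk_hom _ _ _ _ _

@[simp]
lemma inducedE_s : B.inducedE p ≫ B.inducedS p = 𝟙 X := inducedMk_s _ _ _ _ _

@[simp]
lemma inducedE_t : B.inducedE p ≫ B.inducedT p = 𝟙 X := inducedMk_t _ _ _ _ _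

lemma inducedE_comp {Y : C} (f : Y ⟶ B.inducedA₁ p) :
    inducedComp (f ≫ B.inducedS p ≫ B.inducedE p) f (by simp) = f := by
  apply induced_ext
  · rw [inducedComp_hom]
    refine (B.comp_congr ?_ rfl _).trans (B.e_comp _)
    rw [Category.assoc, Category.assoc, inducedE_hom, Category.assoc,
      reassoc_of% B.inducedHom_s p]
  · simp
  · simp

lemma comp_inducedE {Y : C} (f : Y ⟶ B.inducedA₁ p) :
    inducedComp f (f ≫ B.inducedT p ≫ B.inducedE p) (by simp) = f := by
  apply induced_ext
  · rw [inducedComp_hom]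
    refine (B.comp_congr rfl ?_ _).trans (B.comp_e _)
    rw [Category.assoc, Category.assoc, inducedE_hom, Category.assoc,
      reassoc_of% B.inducedHom_t p]
  · simp
  · simp

/-- The composition of the full internal category on `p`. -/
def inducedM : pullback (B.inducedT p) (B.inducedS p) ⟶ B.inducedA₁ p :=
  inducedComp (pullback.fst _ _) (pullback.snd _ _) pullback.condition

lemma inducedM_s : inducedM ≫ B.inducedS p =
    pullback.fst (B.inducedT p) (B.inducedS p) ≫ B.inducedS p := inducedComp_s _ _ _

lemma inducedM_t : inducedM ≫ B.inducedT p =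
    pullback.snd (B.inducedT p) (B.inducedS p) ≫ B.inducedT p := inducedComp_t _ _ _

lemma lift_inducedM {Y : C} (f g : Y ⟶ B.inducedA₁ p)
    (h : f ≫ B.inducedT p = g ≫ B.inducedS p) :
    pullback.lift f g h ≫ inducedM = inducedComp f g h := by
  rw [inducedM, inducedComp, comp_inducedMk]
  apply induced_ext
  · rw [inducedMk_hom, precomp_comp, inducedComp, inducedMk_hom]
    exact B.comp_congr (by simp) (by simp) _
  · simp
  · simp

variable (B p)

/-- The full internal category of `B` on an object `p : X ⟶ B₀` over the object of objects. -/
def induced : InternalCategory C where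
  A₀ := X
  A₁ := B.inducedA₁ p
  s := B.inducedS p
  t := B.inducedT p
  e := B.inducedE p
  m := inducedM
  e_s := inducedE_s
  e_t := inducedE_t
  m_s := inducedM_s
  m_t := inducedM_t
  e_m := by
    refine (lift_inducedM _ _ _).trans ((inducedComp_congr ?_ rfl _).trans (inducedE_comp (𝟙 _)))
    rw [Category.id_comp]
  m_e := by
    refine (lift_inducedM _ _ _).trans ((inducedComp_congr rfl ?_ _).trans (comp_inducedE (𝟙 _)))
    rw [Category.id_comp]
  assoc f g h w₁ w₂ := by
    refine (lift_inducedM _ _ _).trans (Eq.trans ?_ (lift_inducedM _ _ _).symm)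
    exact (inducedComp_congr (lift_inducedM _ _ _) rfl _).trans ((inducedComp_assoc f g h w₁ w₂).trans
      (inducedComp_congr rfl (lift_inducedM _ _ _).symm _))

/-- The fully faithful internal functor from the full internal category on `p`. -/
def inducedFunctor : B.induced p ⟶ B where
  F₀ := p
  F₁ := B.inducedHom p
  map_s := B.inducedHom_s p
  map_t := B.inducedHom_t p
  map_e := inducedE_hom
  map_m := inducedComp_hom _ _ pullback.condition

/-- Checked on all generalized elements, where a morphism of the full internal category is by
construction a morphism of `B` with chosen endpoints. -/
lemma fullyFaithful_inducedFunctor : fullyFaithful (B.inducedFunctor p) :=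
  fullyFaithful_of_points (𝟭 C)
    (fun _ ↦ ⟨fun {a b} g ↦ ⟨⟨inducedMk g.1 a.pt b.pt g.2.1 g.2.2, inducedMk_s _ _ _ _ _,
      inducedMk_t _ _ _ _ _⟩, Points.hom_ext (inducedMk_hom _ _ _ g.2.1 g.2.2)⟩⟩)
    (fun _ ↦ ⟨fun {_ _ f g} h ↦ Points.hom_ext (induced_ext (congrArg Subtype.val h)
      (f.2.1.trans g.2.1.symm) (f.2.2.trans g.2.2.symm))⟩)

end Induced

end InternalCategory

/-! ### Levelwise classes of natural transformations -/

section FunctorCategory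

variable {D : Type*} [Category* D] (W : MorphismProperty D) (J : Type*) [Category* J]

instance [W.IsStableUnderComposition] : (W.functorCategory J).IsStableUnderComposition where
  comp_mem _ _ hf hg j := W.comp_mem _ _ (hf j) (hg j)

instance [W.ContainsIdentities] : (W.functorCategory J).ContainsIdentities where
  id_mem _ _ := W.id_mem _

instance [W.HasTwoOutOfThreeProperty] : (W.functorCategory J).HasTwoOutOfThreeProperty where
  of_postcomp _ _ hg hfg j := W.of_postcomp _ _ (hg j) (hfg j)
  of_precomp _ _ hf hfg j := W.of_precomp _ _ (hf j) (hfg j)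

end FunctorCategory

instance : catEquivalences.{u}.ContainsIdentities where
  id_mem D := (inferInstance : (𝟭 D).IsEquivalence)

namespace InternalCategory

variable {C : Type u} [Category.{v} C] [HasFiniteLimits C]

section

variable {S : Type*} [Category* S] (ι : S ⥤ C)

instance : (nerveEquivalences ι).ContainsIdentities :=
  inferInstanceAs ((catEquivalences.functorCategory Sᵒᵖ).inverseImage _).ContainsIdentities

instance : (nerveEquivalences ι).HasTwoOutOfThreeProperty :=
  inferInstanceAs ((catEquivalences.functorCategory Sᵒᵖ).inverseImage _).HasTwoOutOfThreeProperty

end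

/-! ### Factorizations -/

section CellFactorization

variable {S : Type w} [Category* S] (ι : S ⥤ C)

/-- Against an acyclic fibration only objects have to be lifted: the lift is prescribed on `A₀`, and
on each added cell it exists by surjectivity on `ι`-points. Full faithfulness does the rest. -/
lemma lift_of_cells [HasBinaryCoproducts C] [HasCoproducts.{max w v} C] [ι.IsPointDense]
    {A B X Y : InternalCategory C} (F : A ⟶ B) (q : X ⟶ Y)
    (hq : (nerveFibrations ι ⊓ nerveEquivalences ι) q)
    {T : Type (max w v)} (n : T → S) (i : B.A₀ ≅ A.A₀ ⨿ ∐ fun t : T ↦ ι.obj (n t))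
    (hi : F.F₀ ≫ i.hom = coprod.inl) : HasLiftingProperty F q := by
  obtain ⟨h₁, h₂⟩ := (nerve_acyclicFibrations_iff ι q).1 hq
  refine ⟨fun {f g} sq ↦ ?_⟩
  have w₀ : f.F₀ ≫ q.F₀ = F.F₀ ≫ g.F₀ := congrArg Hom.F₀ sq.w
  choose x hx using fun t : T ↦ h₂ (n t) (Sigma.ι (fun t : T ↦ ι.obj (n t)) t ≫
    coprod.inr ≫ i.inv ≫ g.F₀)
  have hi' : F.F₀ = coprod.inl ≫ i.inv := by rw [← hi, Category.assoc, i.hom_inv_id,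
    Category.comp_id]
  obtain ⟨L, hL, hL₀⟩ := h₁.exists_lift g (i.hom ≫ coprod.desc f.F₀ (Sigma.desc x)) (by
    rw [Category.assoc, ← Iso.eq_inv_comp]
    ext t
    · rw [coprod.inl_desc_assoc, w₀, hi', Category.assoc]
    · rw [coprod.inr_desc_assoc, Sigma.ι_desc_assoc, hx])
  refine ⟨⟨⟨L, h₁.hom_ext ?_ ?_, hL⟩⟩⟩
  · rw [Category.assoc, hL, sq.w]
  · rw [comp_F₀, hL₀, reassoc_of% hi, coprod.inl_desc]

instance [HasBinaryCoproducts C] [HasCoproducts.{max w v} C] [ι.IsPointDense] :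
    (nerveFibrations ι ⊓ nerveEquivalences ι).llp.HasFactorization
      (nerveFibrations ι ⊓ nerveEquivalences ι) where
  nonempty_mapFactorizationData {A B} F := by
    -- One cell for every `ι`-point of `B₀` makes the new object map surjective on `ι`-points in a
    -- single stage; the full internal category on it makes the second factor fully faithful.
    let T := Σ n : S, (ι.obj n ⟶ B.A₀)
    let p : (A.A₀ ⨿ ∐ fun t : T ↦ ι.obj t.1) ⟶ B.A₀ := coprod.desc F.F₀ (Sigma.desc fun t ↦ t.2)
    have hp : coprod.inl ≫ p = F.F₀ := coprod.inl_desc _ _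
    obtain ⟨G, hG, hG₀⟩ := (B.fullyFaithful_inducedFunctor p).exists_lift F coprod.inl hp
    exact ⟨{
      Z := B.induced p
      i := G
      p := B.inducedFunctor p
      fac := hG
      hi := fun _ _ q hq ↦ lift_of_cells ι G q hq (fun t : T ↦ t.1) (Iso.refl _)
        ((Category.comp_id _).trans hG₀)
      hp := (nerve_acyclicFibrations_iff ι _).2 ⟨B.fullyFaithful_inducedFunctor p, fun n y ↦
        ⟨Sigma.ι (fun t : T ↦ ι.obj t.1) ⟨n, y⟩ ≫ coprod.inr, by
          refine (Category.assoc _ _ _).trans ?_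
          exact (congrArg _ (coprod.inr_desc _ _)).trans (Sigma.ι_desc _ _)⟩⟩ }⟩

end CellFactorization

/-! ### The mapping path factorization -/

section PathFactorization

variable {A B : InternalCategory C} (F : A ⟶ B)

/-- The mapping path internal category: its objects are the isomorphisms `b ≅ F a`, and its
morphisms those of `A`. -/
def pathCategory : InternalCategory C := A.induced (pullback.fst F.F₀ (B.isoHom ≫ B.t))

/-- The projection of the mapping path category to `A`. -/
def pathProj : pathCategory F ⟶ A := A.inducedFunctor _

lemma fullyFaithful_pathProj : fullyFaithful (pathProj F) := A.fullyFaithful_inducedFunctor _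

/-- The action on points of the evaluation at the source of an isomorphism `b ≅ F a`. -/
def pathEvalPoints (X : C) : Points (pathCategory F) X ⥤ Points B X :=
  (Points.postcomp (pathProj F) X ⋙ Points.postcomp F X).copyObj
    (fun x ↦ ⟨x.pt ≫ pathSource F⟩) (fun x ↦ (pathIso F x.pt).symm)

lemma pathEvalPoints_map {X : C} {x y : Points (pathCategory F) X} (f : x ⟶ y) :
    (pathEvalPoints F X).map f = (pathIso F x.pt).hom ≫ (Points.postcomp F X).map
      ((Points.postcomp (pathProj F) X).map f) ≫ (pathIso F y.pt).inv := rfl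

/-- The isomorphisms used for conjugation are natural in the shape of the points. This naturality
lets the functors on points assemble into the internal functor `pathEval`. -/
lemma pathEvalPoints_precomp {X Y : C} (x : Y ⟶ X) :
    Points.precomp (pathCategory F) x ⋙ pathEvalPoints F Y =
      pathEvalPoints F X ⋙ Points.precomp B x := by
  refine Points.functor_ext (fun _ ↦ Category.assoc _ _ _) fun f ↦ ?_
  refine Eq.trans ?_ (B.precomp_comp x _ _ _).symm
  refine B.comp_congr ?_ (Eq.trans ?_ (B.precomp_comp x _ _ _).symm) _
  · exact (congrArg (· ≫ B.isoHom) (Category.assoc _ _ _)).trans (Category.assoc _ _ _)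
  · refine B.comp_congr ?_ ?_ _
    · exact (congrArg (· ≫ F.F₁) (Category.assoc _ _ _)).trans (Category.assoc _ _ _)
    · exact (congrArg (· ≫ B.isoInv) (Category.assoc _ _ _)).trans (Category.assoc _ _ _)

/-- The evaluation of the mapping path category at the source of an isomorphism `b ≅ F a`, on
nerves. -/
def pathEvalNerve : (pointsNerve (𝟭 C)).obj (pathCategory F) ⟶ (pointsNerve (𝟭 C)).obj B where
  app X := (pathEvalPoints F X.unop).toCatHom
  naturality _ _ x := Cat.ext (pathEvalPoints_precomp F x.unop)

/-- The evaluation of the mapping path category at the source of an isomorphism `b ≅ F a`. -/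
def pathEval : pathCategory F ⟶ B := homOfNerveMap (pathEvalNerve F)

lemma postcomp_pathEval (X : C) : Points.postcomp (pathEval F) X = pathEvalPoints F X :=
  congrArg (fun α : (pointsNerve (𝟭 C)).obj (pathCategory F) ⟶ (pointsNerve (𝟭 C)).obj B ↦
    (α.app (op X)).toFunctor) (pointsNerve_map_homOfNerveMap (pathEvalNerve F))

/-- On objects the section is `a ↦ (a, 𝟙 (F a))`; full faithfulness of the projection extends it to
morphisms. -/
lemma exists_pathSection : ∃ G : A ⟶ pathCategory F, G ≫ pathProj F = 𝟙 A ∧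
    G.F₀ = pathPoint F (Iso.refl ((Points.postcomp F _).obj ⟨𝟙 A.A₀⟩)) :=
  (fullyFaithful_pathProj F).exists_lift (𝟙 A) _ (pathPoint_fst F _)

/-- The section of the projection of the mapping path category, given by the identity
isomorphisms. -/
def pathSection : A ⟶ pathCategory F := (exists_pathSection F).choose

lemma pathSection_pathProj : pathSection F ≫ pathProj F = 𝟙 A :=
  (exists_pathSection F).choose_spec.1

lemma pathSection_F₀ :
    (pathSection F).F₀ = pathPoint F (Iso.refl ((Points.postcomp F _).obj ⟨𝟙 A.A₀⟩)) :=
  (exists_pathSection F).choose_spec.2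

/-- An isomorphism carried by a unit has equal endpoints. In this form, conjugation by it can be
discarded. -/
lemma exists_eq_eqToIso {X : C} {a b : Points B X} (φ : a ≅ b) (h : φ.hom.1 = a.pt ≫ B.e) :
    ∃ h : a = b, φ = eqToIso h := by
  obtain rfl : a = b := Points.ext (by rw [← φ.hom.2.2, h, Category.assoc, B.e_t, Category.comp_id])
  exact ⟨rfl, Iso.ext (Points.hom_ext h)⟩

lemma pathIso_pathSection {X : C} (a : X ⟶ A.A₀) :
    ∃ h, pathIso F (a ≫ (pathSection F).F₀) = eqToIso h := by
  apply exists_eq_eqToIso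
  refine (congrArg (· ≫ B.isoHom) (Category.assoc _ _ _)).trans ?_
  have h₁ : (pathSection F).F₀ ≫ pullback.snd F.F₀ (B.isoHom ≫ B.t) =
      isoPoint (Iso.refl ((Points.postcomp F _).obj ⟨𝟙 A.A₀⟩)) :=
    (congrArg (· ≫ _) (pathSection_F₀ F)).trans (pathPoint_snd F _)
  have h₂ : (pathSection F).F₀ ≫ pathSource F = 𝟙 _ ≫ F.F₀ :=
    (congrArg (· ≫ _) (pathSection_F₀ F)).trans (pathPoint_pathSource F _)
  refine Eq.trans ?_ (congrArg (· ≫ B.e) (Category.assoc _ _ _).symm)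
  refine (congrArg (fun k ↦ (a ≫ k) ≫ B.isoHom) h₁).trans
    (Eq.trans ?_ (congrArg (fun k ↦ (a ≫ k) ≫ B.e) h₂).symm)
  rw [Category.assoc, isoPoint_isoHom]
  exact (Category.assoc _ _ _).symm

lemma Points.postcomp_comp {D : InternalCategory C} (G : B ⟶ D) (X : C) :
    Points.postcomp (F ≫ G) X = Points.postcomp F X ⋙ Points.postcomp G X :=
  Points.functor_ext (fun _ ↦ (Category.assoc _ _ _).symm) fun _ ↦ (Category.assoc _ _ _).symm

/-- On points, evaluation conjugates by the chosen isomorphisms, and along the section these are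
identities. -/
lemma pathSection_pathEval : pathSection F ≫ pathEval F = F := by
  apply (pointsNerve (𝟭 C)).map_injective
  refine NatTrans.ext (funext fun X ↦ Cat.ext ?_)
  have h : Points.postcomp (pathSection F) X.unop ⋙ pathEvalPoints F X.unop =
      Points.postcomp F X.unop := by
    refine Points.functor_ext (fun a ↦ ?_) fun {a b} f ↦ ?_
    · obtain ⟨h, -⟩ := pathIso_pathSection F a.pt
      refine (congrArg Points.pt h).trans ?_
      have h' : (a.pt ≫ (pathSection F).F₀) ≫ (pathProj F).F₀ = a.pt :=
        (Category.assoc _ _ _).trans ((congrArg (fun G : A ⟶ A ↦ a.pt ≫ G.F₀)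
          (pathSection_pathProj F)).trans (Category.comp_id _))
      exact congrArg (· ≫ F.F₀) h'
    · obtain ⟨h₁, h₂⟩ := pathIso_pathSection F a.pt
      obtain ⟨h₃, h₄⟩ := pathIso_pathSection F b.pt
      have h' : (f.1 ≫ (pathSection F).F₁) ≫ (pathProj F).F₁ = f.1 :=
        (Category.assoc _ _ _).trans ((congrArg (fun G : A ⟶ A ↦ f.1 ≫ G.F₁)
          (pathSection_pathProj F)).trans (Category.comp_id _))
      have key {x y x' y' : Points B X.unop} (φ : x ≅ x') (ψ : y ≅ y') (g : x' ⟶ y') (h₁ h₃)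
          (h₂ : φ = eqToIso h₁) (h₄ : ψ = eqToIso h₃) : (φ.hom ≫ g ≫ ψ.inv).1 = g.1 := by
        subst h₂ h₄
        exact Points.eqToHom_conj_val h₁ g h₃.symm
      exact (key _ _ _ h₁ h₃ h₂ h₄).trans (congrArg (· ≫ F.F₁) h')
  rw [← postcomp_pathEval] at h
  exact (Points.postcomp_comp _ _ _).trans h

lemma nerveFibrations_pathEval {S : Type*} [Category* S] (ι : S ⥤ C) :
    nerveFibrations ι (pathEval F) := by
  intro n
  have h : IsIsofibration (pathEvalPoints F (ι.obj n.unop)) := by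
    intro x b g
    have := (fullyFaithful_pathProj F).full (ι.obj n.unop)
    have := (fullyFaithful_pathProj F).faithful (ι.obj n.unop)
    -- To lift `g : b ≅ b'` ending at `(a, b' ≅ F a)`, keep `a` and precompose the chosen
    -- isomorphism with `g`. The lifted isomorphism is the one lying over the identity of `a`.
    let x' : Points (pathCategory F) (ι.obj n.unop) :=
      ⟨pathPoint F (g ≪≫ pathIso F x.pt)⟩
    have h₀ : (Points.postcomp (pathProj F) _).obj x' = (Points.postcomp (pathProj F) _).obj x :=
      Points.ext (pathPoint_fst F _)
    have h₁ : (pathEvalPoints F _).obj x' = b := Points.ext (pathPoint_pathSource F _)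
    have h₂ : (pathIso F x'.pt).hom.1 = (g.hom ≫ (pathIso F x.pt).hom).1 :=
      (congrArg (· ≫ B.isoHom) (pathPoint_snd F _)).trans (isoPoint_isoHom _)
    refine ⟨x', (Points.postcomp (pathProj F) _).preimageIso (eqToIso h₀), h₁, ?_⟩
    rw [pathEvalPoints_map, Functor.preimageIso_hom, Functor.map_preimage, eqToIso.hom]
    have h₃ : (pathIso F x'.pt).hom = eqToHom h₁ ≫ (g.hom ≫ (pathIso F x.pt).hom) ≫
        eqToHom (congrArg (Points.postcomp F _).obj h₀.symm) :=
      Points.hom_ext (h₂.trans (Points.eqToHom_conj_val _ _ _).symm)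
    have h₄ : (Points.postcomp F _).map (eqToHom h₀) =
        eqToHom (congrArg (Points.postcomp F _).obj h₀) := eqToHom_map _ _
    refine (congrArg₂ (fun p q ↦ p ≫ q ≫ (pathIso F x.pt).inv) h₃ h₄).trans ?_
    have key {a b c d e : Points B (ι.obj n.unop)} (h : a = b) (g : b ⟶ c) (k : c ≅ d)
        (h' : d = e) (h'' : e = d) :
        (eqToHom h ≫ (g ≫ k.hom) ≫ eqToHom h') ≫ eqToHom h'' ≫ k.inv = eqToHom h ≫ g := by
      subst h h'
      simp
    exact key h₁ g.hom (pathIso F x.pt) _ _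
  rw [← postcomp_pathEval] at h
  exact h

/-- The projection to `A` is fully faithful and split surjective on objects, hence an acyclic
fibration; two-out-of-three passes this to its section. -/
lemma nerveEquivalences_pathSection {S : Type*} [Category* S] (ι : S ⥤ C) [ι.IsPointDense] :
    nerveEquivalences ι (pathSection F) := by
  have h₁ : (nerveFibrations ι ⊓ nerveEquivalences ι) (pathProj F) := by
    refine (nerve_acyclicFibrations_iff ι _).2 ⟨fullyFaithful_pathProj F, fun n y ↦
      ⟨y ≫ (pathSection F).F₀, ?_⟩⟩
    exact (Category.assoc _ _ _).trans ((congrArg (fun G : A ⟶ A ↦ y ≫ G.F₀)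
      (pathSection_pathProj F)).trans (Category.comp_id _))
  refine (nerveEquivalences ι).of_postcomp _ _ h₁.2 ?_
  rw [pathSection_pathProj]
  exact (nerveEquivalences ι).id_mem _

instance {S : Type*} [Category* S] (ι : S ⥤ C) [ι.IsPointDense] :
    (nerveEquivalences ι).HasFactorization (nerveFibrations ι) where
  nonempty_mapFactorizationData F := ⟨{
    Z := pathCategory F
    i := pathSection F
    p := pathEval F
    fac := pathSection_pathEval F
    hi := nerveEquivalences_pathSection F ι
    hp := nerveFibrations_pathEval F ι }⟩

end PathFactorization

end InternalCategory

/-! ### Epimorphisms for the simplicially surjective topology -/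

lemma topologyEpi_iff_isLocallySurjective {C : Type u} [Category.{v} C] [HasFiniteLimits C]
    (T : GrothendieckTopology C) {X Y : C} (p : X ⟶ Y) :
    InternalCategory.topologyEpi T p ↔
      Presheaf.IsLocallySurjective T (uliftYoneda.{u}.map p) := by
  rw [← Presheaf.isLocallySurjective_presheafToSheaf_map_iff, Sheaf.isLocallySurjective_iff_epi']
  rfl

lemma topologyEpi_simpliciallySurjectiveTopology_iff {D E : Cat.{u, u}} (p : D ⟶ E) :
    InternalCategory.topologyEpi simpliciallySurjectiveTopology.{u} p ↔
      InternalCategory.pointSurjective ordinalCat.{u} p := by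
  rw [topologyEpi_iff_isLocallySurjective]
  constructor
  · intro h n y
    -- Local surjectivity at the identity of `E` gives a simplicially surjective functor to `E` that
    -- factors through `p`, so simplices lift along `p`.
    obtain ⟨_, ⟨Z, F, hF, rfl⟩, hR⟩ := h.imageSieve_mem (ULift.up (𝟙 E))
    obtain ⟨t, ht⟩ := hR _ _ (Presieve.singleton_self F)
    obtain ⟨x, hx⟩ := (simpliciallySurjective_iff F).1 hF n.len y
    have ht' : t.down ≫ p = F := (congrArg ULift.down ht).trans (Category.comp_id (X := Z) (Y := E) F)
    exact ⟨x ≫ t.down, by rw [Category.assoc, ht', hx]⟩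
  · intro h
    refine ⟨fun {U} s ↦ ?_⟩
    -- Conversely, the base change of `p` along any `s` is again surjective on simplices, and it is
    -- a cover on which `s` lifts.
    refine ⟨_, ⟨pullback p s.down, pullback.snd p s.down, ?_, rfl⟩, ?_⟩
    · rw [simpliciallySurjective_iff]
      intro k x
      obtain ⟨y, hy⟩ := h ⦋k⦌ (x ≫ s.down)
      exact ⟨pullback.lift y x hy, pullback.lift_snd _ _ _⟩
    · rintro _ _ ⟨⟩
      exact ⟨ULift.up (pullback.fst p s.down), congrArg ULift.up (pullback.condition (f := p) (g := s.down))⟩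

/-! ### Density of the ordinals -/

/-- The simplices of the nerve of a category as functors on ordinals. -/
def ordinalCatHomEquiv (D : Cat.{u, u}) (n : SimplexCategory) :
    (ordinalCat.{u}.obj n ⟶ D) ≃ (nerve D).obj (op n) where
  toFun x := (Monotone.functor (f := ULift.up) fun _ _ h ↦ h : _ ⥤ ULift.{u} (Fin (n.len + 1))) ⋙
    x.toFunctor
  invFun y := ((Monotone.functor (f := ULift.down) fun _ _ h ↦ h :
    ULift.{u} (Fin (n.len + 1)) ⥤ _) ⋙ y).toCatHom
  left_inv _ := rfl
  right_inv _ := rfl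

/-- A restatement of the full faithfulness of the nerve functor from categories to simplicial sets.
-/
instance : ordinalCat.{u}.IsPointDense where
  hom_ext {D E f g} h := by
    apply nerveFunctor.map_injective
    ext n x
    obtain ⟨y, rfl⟩ := (ordinalCatHomEquiv D n.unop).surjective x
    exact congrArg (ordinalCatHomEquiv E n.unop) (h n.unop y)
  exists_hom {D E} φ hφ := by
    let α : nerveFunctor.obj D ⟶ nerveFunctor.obj E :=
      { app n := ↾fun x ↦ ordinalCatHomEquiv E n.unop (φ n.unop ((ordinalCatHomEquiv D n.unop).symm x))
        naturality m n a := by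
          ext x
          exact congrArg (ordinalCatHomEquiv E n.unop) (hφ _ _ a.unop
            ((ordinalCatHomEquiv D m.unop).symm x)) }
    obtain ⟨f, hf⟩ := nerveFunctor.map_surjective α
    refine ⟨f, fun n z ↦ (ordinalCatHomEquiv E n).injective ?_⟩
    exact congrArg (fun β : nerveFunctor.obj D ⟶ nerveFunctor.obj E ↦
      β.app (op n) (ordinalCatHomEquiv D n z)) hf

/-- Full faithfulness is the same condition on both sides, so only the epimorphism condition has to
be compared. -/
lemma topologyEquivalences_eq :
    InternalCategory.topologyEquivalences simpliciallySurjectiveTopology.{u} =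
      InternalCategory.nerveEquivalences ordinalCat.{u} := by
  ext A B F
  rw [InternalCategory.nerveEquivalences_iff]
  exact and_congr_right' (topologyEpi_simpliciallySurjectiveTopology_iff _)

lemma topologyFibrations_eq :
    InternalCategory.topologyFibrations simpliciallySurjectiveTopology.{u} =
      InternalCategory.nerveFibrations ordinalCat.{u} := by
  ext A B F
  rw [InternalCategory.nerveFibrations_iff]
  exact topologyEpi_simpliciallySurjectiveTopology_iff _

/-! ### Simplicial sets satisfying the Segal condition -/

namespace SSet

open SimplexCategory

/-- The Segal condition: an edge and an `n`-simplex starting at its target have a unique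
concatenation. -/
def IsSegal (K : SSet.{u}) : Prop :=
  ∀ (n : ℕ) (f : K.obj (op ⦋1⦌)) (s : K.obj (op ⦋n⦌)),
    K.map (SimplexCategory.const ⦋0⦌ ⦋1⦌ 1).op f = K.map (SimplexCategory.const ⦋0⦌ ⦋n⦌ 0).op s →
      ∃! x : K.obj (op ⦋n + 1⦌), K.map (mkOfLe 0 1 (Fin.zero_le _)).op x = f ∧ K.map (δ 0).op x = s

section

variable {K : SSet.{u}}

lemma map_op_map_op {a b c : SimplexCategory} (f : a ⟶ b) (g : b ⟶ c) (x : K.obj (op c)) :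
    K.map f.op (K.map g.op x) = K.map (f ≫ g).op x := by
  rw [op_comp, Functor.map_comp_apply]

lemma map_op_congr {a b : SimplexCategory} {f g : a ⟶ b} (h : f = g) (x : K.obj (op b)) :
    K.map f.op x = K.map g.op x := by
  rw [h]

/-- The `i`-th vertex of a simplex. -/
def vtx {n : ℕ} (x : K.obj (op ⦋n⦌)) (i : Fin (n + 1)) : K.obj (op ⦋0⦌) :=
  K.map (SimplexCategory.const ⦋0⦌ ⦋n⦌ i).op x

/-- The edge of a simplex between two vertices. -/
def edge {n : ℕ} (x : K.obj (op ⦋n⦌)) (i j : Fin (n + 1)) (h : i ≤ j) : K.obj (op ⦋1⦌) :=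
  K.map (mkOfLe i j h).op x

lemma vtx_map {m n : ℕ} (a : ⦋m⦌ ⟶ ⦋n⦌) (x : K.obj (op ⦋n⦌)) (i : Fin (m + 1)) :
    vtx (K.map a.op x) i = vtx x (a i) := by
  rw [vtx, vtx, map_op_map_op]
  rfl

lemma edge_map {m n : ℕ} (a : ⦋m⦌ ⟶ ⦋n⦌) (x : K.obj (op ⦋n⦌)) (i j : Fin (m + 1)) (h : i ≤ j) :
    edge (K.map a.op x) i j h = edge x (a i) (a j) (a.toOrderHom.monotone h) := by
  rw [edge, edge, map_op_map_op]
  refine map_op_congr ?_ _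
  exact Hom.ext_one_left _ _ rfl rfl

lemma vtx_edge_zero {n : ℕ} (x : K.obj (op ⦋n⦌)) (i j : Fin (n + 1)) (h : i ≤ j) :
    vtx (edge x i j h) 0 = vtx x i := vtx_map _ _ _

lemma vtx_edge_one {n : ℕ} (x : K.obj (op ⦋n⦌)) (i j : Fin (n + 1)) (h : i ≤ j) :
    vtx (edge x i j h) 1 = vtx x j := vtx_map _ _ _

lemma edge_zero_one (f : K.obj (op ⦋1⦌)) : edge f 0 1 (Fin.zero_le _) = f := by
  have : mkOfLe (n := 1) 0 1 (Fin.zero_le _) = 𝟙 _ := Hom.ext_one_left _ _ rfl rfl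
  rw [edge, this, op_id, Functor.map_id_apply]

lemma vtx_zero (x : K.obj (op ⦋0⦌)) : vtx x 0 = x := by
  rw [vtx, const_eq_id, op_id, Functor.map_id_apply]

/-- The degenerate edge at a vertex. -/
def idEdge (x : K.obj (op ⦋0⦌)) : K.obj (op ⦋1⦌) := K.map (SimplexCategory.const ⦋1⦌ ⦋0⦌ 0).op x

lemma vtx_idEdge (x : K.obj (op ⦋0⦌)) (i : Fin 2) : vtx (idEdge x) i = x :=
  (vtx_map _ _ _).trans (vtx_zero x)

lemma edge_self {n : ℕ} (x : K.obj (op ⦋n⦌)) (i : Fin (n + 1)) :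
    edge x i i le_rfl = idEdge (vtx x i) := by
  rw [edge, idEdge, vtx, map_op_map_op]
  refine map_op_congr ?_ _
  exact Hom.ext_one_left _ _ rfl rfl

end

namespace IsSegal

variable {K : SSet.{u}} (hK : K.IsSegal)

/-- The composite of two edges. -/
def comp (f g : K.obj (op ⦋1⦌)) (h : vtx f 1 = vtx g 0) : K.obj (op ⦋1⦌) :=
  edge (hK 1 f g h).choose 0 2 (Fin.zero_le _)

lemma comp_congr {f g f' g' : K.obj (op ⦋1⦌)} (hf : f = f') (hg : g = g')
    (h : vtx f 1 = vtx g 0) : hK.comp f g h = hK.comp f' g' (by rw [← hf, ← hg, h]) := by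
  subst hf hg; rfl

/-- By uniqueness of the filler, composites can be read off from any simplex containing the two
edges. The category axioms all follow from this. -/
lemma comp_edge {n : ℕ} (x : K.obj (op ⦋n⦌)) (i j k : Fin (n + 1)) (hij : i ≤ j) (hjk : j ≤ k) :
    hK.comp (edge x i j hij) (edge x j k hjk) (by rw [vtx_edge_zero, vtx_edge_one]) =
      edge x i k (hij.trans hjk) := by
  have h : vtx (edge x i j hij) 1 = vtx (edge x j k hjk) 0 := by
    rw [vtx_edge_zero, vtx_edge_one]
  have h₁ : (hK 1 _ _ h).choose = K.map (mkOfLeComp i j k hij hjk).op x := by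
    refine (hK 1 _ _ h).unique (hK 1 _ _ h).choose_spec.1 ⟨edge_map _ _ _ _ _, ?_⟩
    rw [map_op_map_op, edge]
    refine map_op_congr ?_ _
    exact Hom.ext_one_left _ _ rfl rfl
  rw [comp, h₁]
  exact edge_map _ _ _ _ _

include hK in
lemma exists_triangle (f g : K.obj (op ⦋1⦌)) (h : vtx f 1 = vtx g 0) :
    ∃ x : K.obj (op ⦋2⦌), edge x 0 1 (Fin.zero_le _) = f ∧ K.map (δ 0).op x = g :=
  (hK 1 f g h).exists

lemma edge_one_two (x : K.obj (op ⦋2⦌)) : edge x 1 2 (by decide) = K.map (δ 0).op x := by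
  rw [edge]
  refine map_op_congr ?_ _
  exact Hom.ext_one_left _ _ rfl rfl

lemma vtx_comp_zero (f g : K.obj (op ⦋1⦌)) (h : vtx f 1 = vtx g 0) :
    vtx (hK.comp f g h) 0 = vtx f 0 := by
  obtain ⟨x, rfl, rfl⟩ := hK.exists_triangle f g h
  rw [hK.comp_congr rfl (edge_one_two x).symm, hK.comp_edge, vtx_edge_zero, vtx_edge_zero]

lemma vtx_comp_one (f g : K.obj (op ⦋1⦌)) (h : vtx f 1 = vtx g 0) :
    vtx (hK.comp f g h) 1 = vtx g 1 := by
  obtain ⟨x, rfl, rfl⟩ := hK.exists_triangle f g h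
  rw [hK.comp_congr rfl (edge_one_two x).symm, hK.comp_edge, vtx_edge_one, ← edge_one_two,
    vtx_edge_one]

lemma id_comp (f : K.obj (op ⦋1⦌)) :
    hK.comp (idEdge (vtx f 0)) f (vtx_idEdge _ _) = f := by
  rw [hK.comp_congr (edge_self f 0).symm (edge_zero_one f).symm, hK.comp_edge, edge_zero_one]

lemma comp_id (f : K.obj (op ⦋1⦌)) :
    hK.comp f (idEdge (vtx f 1)) (vtx_idEdge _ _).symm = f := by
  rw [hK.comp_congr (edge_zero_one f).symm (edge_self f 1).symm, hK.comp_edge, edge_zero_one]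

/-- Both bracketings are the edge from vertex 0 to vertex 3 of the 3-simplex that concatenates `f`
with a triangle on `g` and `k`. -/
lemma assoc (f g k : K.obj (op ⦋1⦌)) (h : vtx f 1 = vtx g 0) (h' : vtx g 1 = vtx k 0) :
    hK.comp (hK.comp f g h) k (by rw [vtx_comp_one, h']) =
      hK.comp f (hK.comp g k h') (by rw [vtx_comp_zero, h]) := by
  obtain ⟨y, rfl, rfl⟩ := hK.exists_triangle g k h'
  rw [vtx_edge_zero] at h
  obtain ⟨x, ⟨hx₁, hx₂⟩, -⟩ := hK 2 f y h
  replace hx₁ : edge x 0 1 (Fin.zero_le _) = f := hx₁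
  have h₁ : edge y 0 1 (Fin.zero_le _) = edge x 1 2 (by decide) := by
    rw [← hx₂, edge_map]; rfl
  have h₂ : K.map (δ 0).op y = edge x 2 3 (by decide) := by
    rw [← edge_one_two, ← hx₂, edge_map]; rfl
  have e₁ := hK.comp_edge x 0 1 2 (by decide) (by decide)
  have e₂ := hK.comp_edge x 1 2 3 (by decide) (by decide)
  have e₃ := hK.comp_edge x 0 2 3 (by decide) (by decide)
  have e₄ := hK.comp_edge x 0 1 3 (by decide) (by decide)
  calc _ = _ := hK.comp_congr ((hK.comp_congr hx₁.symm h₁ _).trans e₁) h₂ _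
    _ = _ := e₃.trans e₄.symm
    _ = _ := (hK.comp_congr hx₁.symm ((hK.comp_congr h₁ h₂ _).trans e₂) _).symm

end IsSegal

/-- The objects of the category attached to a simplicial set satisfying the Segal condition. -/
@[ext]
structure SegalObj {K : SSet.{u}} (hK : K.IsSegal) : Type u where
  pt : K.obj (op ⦋0⦌)

namespace SegalObj

variable {K : SSet.{u}} (hK : K.IsSegal)

instance : Category.{u} (SegalObj hK) where
  Hom x y := {f : K.obj (op ⦋1⦌) // vtx f 0 = x.pt ∧ vtx f 1 = y.pt}
  id x := ⟨idEdge x.pt, vtx_idEdge _ _, vtx_idEdge _ _⟩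
  comp f g := ⟨hK.comp f.1 g.1 (f.2.2.trans g.2.1.symm), (hK.vtx_comp_zero _ _ _).trans f.2.1,
    (hK.vtx_comp_one _ _ _).trans g.2.2⟩
  id_comp f := Subtype.ext ((hK.comp_congr (by rw [f.2.1]) rfl
    ((vtx_idEdge _ _).trans f.2.1.symm)).trans (hK.id_comp f.1))
  comp_id f := Subtype.ext ((hK.comp_congr rfl (by rw [f.2.2])
    (f.2.2.trans (vtx_idEdge _ _).symm)).trans (hK.comp_id f.1))
  assoc f g h := Subtype.ext (hK.assoc f.1 g.1 h.1 (f.2.2.trans g.2.1.symm) (g.2.2.trans h.2.1.symm))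

variable {hK}

lemma eqToHom_conj_val {a b a' b' : SegalObj hK} (h : a = a') (f : a' ⟶ b') (h' : b' = b) :
    (eqToHom h ≫ f ≫ eqToHom h').1 = f.1 := by
  subst h h'; simp

lemma functor_ext {D : Type*} [Category* D] {F G : D ⥤ SegalObj hK}
    (h₀ : ∀ d, (F.obj d).pt = (G.obj d).pt)
    (h₁ : ∀ {d d' : D} (f : d ⟶ d'), (F.map f).1 = (G.map f).1) : F = G :=
  CategoryTheory.Functor.ext (fun d ↦ SegalObj.ext (h₀ d)) fun _ _ f ↦
    Subtype.ext ((h₁ f).trans (eqToHom_conj_val _ _ _).symm)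

/-- The functor on an ordinal given by a simplex. -/
def ofSimplex {n : ℕ} (x : K.obj (op ⦋n⦌)) : Fin (n + 1) ⥤ SegalObj hK where
  obj i := ⟨vtx x i⟩
  map {i j} h := ⟨edge x i j h.le, vtx_edge_zero _ _ _ _, vtx_edge_one _ _ _ _⟩
  map_id i := Subtype.ext (edge_self x i)
  map_comp f g := Subtype.ext (hK.comp_edge x _ _ _ f.le g.le).symm

variable (hK) in
/-- The comparison of a simplicial set satisfying the Segal condition with the nerve of the
attached category. -/
def toNerve : K ⟶ nerve (SegalObj hK) where
  app n := ↾fun x ↦ ofSimplex (n := n.unop.len) x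
  naturality m n a := by
    ext x
    exact functor_ext (fun i ↦ vtx_map a.unop x i) fun {i j} h ↦ edge_map a.unop x i j h.le

/-- Induction on dimension: the Segal condition recovers a simplex from its first edge and its last
face, and the associated functor determines both. -/
lemma ofSimplex_injective (n : ℕ) :
    Function.Injective (ofSimplex (hK := hK) (n := n)) := by
  induction n with
  | zero =>
    intro x y h
    have := congrArg SegalObj.pt (Functor.congr_obj h 0)
    exact (vtx_zero x).symm.trans (this.trans (vtx_zero y))
  | succ n ih =>
    intro x y h
    have h₁ : edge x 0 1 (Fin.zero_le _) = edge y 0 1 (Fin.zero_le _) :=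
      (congrArg Subtype.val (Functor.congr_hom h (homOfLE (Fin.zero_le 1)))).trans
        (eqToHom_conj_val _ _ _)
    have h₂ : K.map (δ 0).op x = K.map (δ 0).op y := ih (functor_ext
      (fun i ↦ (vtx_map _ _ _).trans ((congrArg SegalObj.pt (Functor.congr_obj h _)).trans
        (vtx_map _ _ _).symm))
      (fun {i j} a ↦ (edge_map _ _ _ _ _).trans (((congrArg Subtype.val (Functor.congr_hom h
        (homOfLE ((δ 0 : ⦋n⦌ ⟶ ⦋n + 1⦌).toOrderHom.monotone a.le)))).trans
        (eqToHom_conj_val _ _ _)).trans (edge_map _ _ _ _ _).symm)))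
    have h₃ : vtx (edge y 0 1 (Fin.zero_le _)) 1 = vtx (K.map (δ 0).op y) 0 :=
      (vtx_edge_one _ _ _ _).trans (vtx_map (δ 0) y 0).symm
    exact (hK n _ _ h₃).unique ⟨h₁, h₂⟩ ⟨rfl, rfl⟩

lemma ofSimplex_surjective (n : ℕ) :
    Function.Surjective (ofSimplex (hK := hK) (n := n)) := by
  induction n with
  | zero =>
    intro F
    refine ⟨(F.obj 0).pt, ComposableArrows.ext₀ (SegalObj.ext (vtx_zero _))⟩
  | succ n ih =>
    intro F
    let f := F.map (homOfLE (Fin.zero_le 1))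
    obtain ⟨s, hs⟩ := ih (ComposableArrows.δ₀ F)
    have hs₀ (i : Fin (n + 1)) : vtx s i = (F.obj i.succ).pt :=
      congrArg SegalObj.pt (Functor.congr_obj hs i)
    obtain ⟨x, ⟨hx₁, hx₂⟩, -⟩ := hK n f.1 s (f.2.2.trans (hs₀ 0).symm)
    have hx₁' : edge x 0 1 (Fin.zero_le _) = f.1 := hx₁
    have h₀ : (ofSimplex (hK := hK) x).obj 0 = F.obj 0 := SegalObj.ext (by
      rw [← f.2.1, ← hx₁', vtx_edge_zero]; rfl)
    refine ⟨x, ComposableArrows.ext_succ h₀ (Eq.trans ?_ hs) (Subtype.ext ?_)⟩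
    · rw [← hx₂]
      exact functor_ext (fun i ↦ (vtx_map (δ 0) x i).symm)
        (fun {i j} a ↦ (edge_map (δ 0) x i j a.le).symm)
    · exact hx₁'.trans (eqToHom_conj_val _ _ _).symm

instance : IsIso (toNerve hK) := by
  rw [NatTrans.isIso_iff_isIso_app]
  intro n
  rw [isIso_iff_bijective]
  exact ⟨ofSimplex_injective n.unop.len, ofSimplex_surjective n.unop.len⟩

end SegalObj

/-- The concatenation prepends the edge to the string. The end of the edge and the start of the
string agree only propositionally, hence the transports. -/
lemma isSegal_nerve (D : Type u) [Category.{u} D] : (nerve D).IsSegal := by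
  intro n f s h
  refine ⟨ComposableArrows.precomp s (f.map' 0 1 ≫ eqToHom (Functor.congr_obj h 0)), ⟨?_, rfl⟩, ?_⟩
  · refine ComposableArrows.ext₁ rfl (Functor.congr_obj h 0).symm ?_
    exact (Category.id_comp _).symm
  · rintro y ⟨hy₁, rfl⟩
    refine ComposableArrows.ext_succ (Functor.congr_obj hy₁ 0) rfl ?_
    have key {a b c d e : D} (h₁ : a = b) (k : b ⟶ c) (h₂ : c = d) (h₃ : c = e) (h₄ : e = d) :
        eqToHom h₁ ≫ k ≫ eqToHom h₂ = eqToHom h₁ ≫ (k ≫ eqToHom h₃) ≫ eqToHom h₄ := by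
      subst h₁ h₂ h₃
      simp
    exact (Functor.congr_hom hy₁ (homOfLE (Fin.zero_le 1))).trans (key _ _ _ _ _)

end SSet

/-! ### Local objects in locally presentable categories -/

section Presentable

variable {C : Type*} [Category* C]

/-- Each object is presentable for some cardinal of its own; a regular cardinal above this small
family of cardinals serves for all. -/
lemma exists_regular_isCardinalPresentable {T : Type*} [Small.{w} T] (X : T → C)
    [∀ t, IsPresentable.{w} (X t)] :
    ∃ (κ : Cardinal.{w}) (_ : Fact κ.IsRegular), ∀ t, IsCardinalPresentable (X t) κ := by
  choose k hk hk' using fun t ↦ Functor.IsAccessible.exists_cardinal.{w}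
    (F := coyoneda.obj (op (X t)))
  obtain ⟨κ, h₁, h₂⟩ := HasCardinalLT.exists_regular_cardinal_forall.{w}
    (fun t : T ↦ (k t).ord.ToType)
  have : Fact κ.IsRegular := ⟨h₁⟩
  refine ⟨κ, inferInstance, fun t ↦ ?_⟩
  have := hk t
  have : IsCardinalPresentable (X t) (k t) := hk' t
  exact isCardinalPresentable_of_le (κ := k t) _
    (le_of_lt (by simpa [hasCardinalLT_iff_cardinal_mk_lt] using h₂ t))

lemma exists_regular_ofHoms_isCardinalPresentable [∀ X : C, IsPresentable.{w} X] {T : Type*}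
    [Small.{w} T] {X Y : T → C} (f : ∀ t, X t ⟶ Y t) :
    ∃ (κ : Cardinal.{w}) (_ : Fact κ.IsRegular), ∀ ⦃A B : C⦄ (g : A ⟶ B),
      MorphismProperty.ofHoms f g → IsCardinalPresentable A κ ∧ IsCardinalPresentable B κ := by
  obtain ⟨κ, hκ, h⟩ := exists_regular_isCardinalPresentable.{w} (Sum.elim X Y)
  refine ⟨κ, hκ, ?_⟩
  rintro _ _ _ ⟨t⟩
  exact ⟨h (Sum.inl t), h (Sum.inr t)⟩

end Presentable

section AsSmall

/-- Presheaves on the simplex category, indexed by a small category in a given universe. -/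
def simplicialObjectEquivalence (A : Type*) [Category* A] :
    ((AsSmall.{u} SimplexCategory)ᵒᵖ ⥤ A) ≌ SimplicialObject A :=
  Equivalence.congrLeft (AsSmall.equiv (C := SimplexCategory)).op.symm

instance (κ : Cardinal.{u}) [Fact κ.IsRegular] : IsCardinalLocallyPresentable SSet.{u} κ :=
  (simplicialObjectEquivalence.{u} (Type u)).isCardinalLocallyPresentable κ

instance : IsLocallyPresentable.{u} SSet.{u} :=
  ⟨_, Cardinal.fact_isRegular_aleph0, inferInstance⟩

end AsSmall

/-! ### The Segal condition as locality -/

namespace SSet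

open SimplexCategory

lemma stdSimplex_map_yonedaEquiv_symm {K : SSet.{u}} {m n : SimplexCategory} (a : m ⟶ n)
    (x : K.obj (op n)) :
    SSet.stdSimplex.{u}.map a ≫ yonedaEquiv.symm x = yonedaEquiv.symm (K.map a.op x) :=
  (uliftYonedaEquiv_symm_map a.op x).symm

/-- The union of an edge and an `n`-simplex starting at its target. -/
abbrev segalSource (n : ℕ) : SSet.{u} :=
  pushout (stdSimplex.{u}.map (SimplexCategory.const ⦋0⦌ ⦋1⦌ 1))
    (stdSimplex.{u}.map (SimplexCategory.const ⦋0⦌ ⦋n⦌ 0))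

/-- The inclusion in the `n + 1`-simplex of its first edge and its last face. -/
def segalMap (n : ℕ) : segalSource.{u} n ⟶ stdSimplex.{u}.obj ⦋n + 1⦌ :=
  pushout.desc (SSet.stdSimplex.{u}.map (mkOfLe 0 1 (Fin.zero_le _)))
    (SSet.stdSimplex.{u}.map (δ 0))
    ((SSet.stdSimplex.{u}.map_comp _ _).symm.trans (SSet.stdSimplex.{u}.map_comp _ _))

/-- By Yoneda and the pushout property, a map out of `segalSource n` is an edge and an `n`-simplex
that match at a vertex. -/
lemma bijective_segalMap_iff (K : SSet.{u}) (n : ℕ) :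
    Function.Bijective (fun g : stdSimplex.{u}.obj ⦋n + 1⦌ ⟶ K ↦ segalMap n ≫ g) ↔
      ∀ (f : K.obj (op ⦋1⦌)) (s : K.obj (op ⦋n⦌)),
        K.map (SimplexCategory.const ⦋0⦌ ⦋1⦌ 1).op f =
          K.map (SimplexCategory.const ⦋0⦌ ⦋n⦌ 0).op s →
        ∃! x : K.obj (op ⦋n + 1⦌), K.map (mkOfLe 0 1 (Fin.zero_le _)).op x = f ∧
          K.map (δ 0).op x = s := by
  have key (p : segalSource n ⟶ K) (x : K.obj (op ⦋n + 1⦌)) :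
      segalMap n ≫ yonedaEquiv.symm x = p ↔
        K.map (mkOfLe 0 1 (Fin.zero_le _)).op x = yonedaEquiv (pushout.inl _ _ ≫ p) ∧
          K.map (δ 0).op x = yonedaEquiv (pushout.inr _ _ ≫ p) := by
    rw [← Equiv.symm_apply_eq, ← Equiv.symm_apply_eq, ← stdSimplex_map_yonedaEquiv_symm,
      ← stdSimplex_map_yonedaEquiv_symm]
    constructor
    · rintro rfl
      exact ⟨(pushout.inl_desc_assoc _ _ _ _).symm, (pushout.inr_desc_assoc _ _ _ _).symm⟩
    · rintro ⟨h₁, h₂⟩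
      apply pushout.hom_ext
      · exact (pushout.inl_desc_assoc _ _ _ _).trans h₁
      · exact (pushout.inr_desc_assoc _ _ _ _).trans h₂
  have h₁ : Function.Bijective (fun g : stdSimplex.{u}.obj ⦋n + 1⦌ ⟶ K ↦ segalMap n ≫ g) ↔
      ∀ p : segalSource n ⟶ K, ∃! x : K.obj (op ⦋n + 1⦌),
        segalMap n ≫ yonedaEquiv.symm x = p := by
    rw [← Function.Bijective.of_comp_iff _ (yonedaEquiv (X := K) (n := ⦋n + 1⦌)).symm.bijective,
      Function.bijective_iff_existsUnique]
    rfl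
  rw [h₁]
  constructor
  · intro h f s w
    have := h (pushout.desc (yonedaEquiv.symm f) (yonedaEquiv.symm s) (by
      rw [stdSimplex_map_yonedaEquiv_symm, stdSimplex_map_yonedaEquiv_symm, w]))
    simpa only [key, pushout.inl_desc, pushout.inr_desc, Equiv.apply_symm_apply] using this
  · intro h p
    simp only [key]
    apply h
    apply yonedaEquiv.symm.injective
    rw [← stdSimplex_map_yonedaEquiv_symm, ← stdSimplex_map_yonedaEquiv_symm,
      Equiv.symm_apply_apply, Equiv.symm_apply_apply, pushout.condition_assoc]

/-- The class of Segal maps. -/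
abbrev segalMaps : MorphismProperty SSet.{u} := MorphismProperty.ofHoms segalMap.{u}

lemma isLocal_segalMaps_iff (K : SSet.{u}) : segalMaps.isLocal K ↔ K.IsSegal := by
  constructor
  · intro h n
    exact (bijective_segalMap_iff K n).1 (h _ ⟨n⟩)
  · rintro h _ _ _ ⟨n⟩
    exact (bijective_segalMap_iff K n).2 (h n)

lemma IsSegal.of_iso {K L : SSet.{u}} (hK : K.IsSegal) (e : K ≅ L) : L.IsSegal :=
  (isLocal_segalMaps_iff L).1 (segalMaps.isLocal.prop_of_iso e ((isLocal_segalMaps_iff K).2 hK))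

end SSet

/-! ### Local presentability of simplicial categories -/

/-- The nerve of a category as a local object. -/
def nerveSegal : Cat.{u, u} ⥤ SSet.segalMaps.{u}.isLocal.FullSubcategory :=
  SSet.segalMaps.isLocal.lift nerveFunctor
    fun D ↦ (SSet.isLocal_segalMaps_iff _).2 (SSet.isSegal_nerve D)

instance : nerveSegal.{u}.IsEquivalence where
  full := inferInstanceAs (SSet.segalMaps.isLocal.lift nerveFunctor _).Full
  faithful := inferInstanceAs (SSet.segalMaps.isLocal.lift nerveFunctor _).Faithful
  essSurj := ⟨fun K ↦ by
    have hK := (SSet.isLocal_segalMaps_iff _).1 K.2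
    exact ⟨Cat.of (SSet.SegalObj hK), ⟨SSet.segalMaps.isLocal.isoMk
      (asIso (SSet.SegalObj.toNerve hK)).symm⟩⟩⟩

/-- Through the nerve, `Cat` is the category of simplicial sets local for the countably many Segal
maps, and localities of this kind inherit local presentability. -/
instance : IsLocallyPresentable.{u} Cat.{u, u} := by
  obtain ⟨κ, _, h⟩ := exists_regular_ofHoms_isCardinalPresentable.{u} SSet.segalMap.{u}
  have : MorphismProperty.IsSmall.{u} SSet.segalMaps.{u} := MorphismProperty.isSmall_ofHoms _
  have := MorphismProperty.isLocallyPresentable_isLocal SSet.segalMaps.{u} κ h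
  exact ⟨κ, inferInstance, nerveSegal.{u}.asEquivalence.symm.isCardinalLocallyPresentable κ⟩

instance : IsLocallyPresentable.{u} (SimplicialObject Cat.{u, u}) :=
  (simplicialObjectEquivalence.{u} Cat.{u, u}).isLocallyPresentable

/-! ### The reflection of simplicial categories on double categories -/

/-- The functor sending a category to its set of arrows. -/
def catArrows : Cat.{u, u} ⥤ Type u where
  obj D := Arrow D
  map F := ↾F.toFunctor.mapArrow.obj

/-- The set of arrows is represented by the ordinal `[1]`. -/
def catArrowsIso : coyoneda.obj (op (ordinalCat.{u}.obj ⦋1⦌)) ≅ catArrows.{u} :=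
  NatIso.ofComponents (fun D ↦
    ((ordinalCatHomEquiv D ⦋1⦌).trans ComposableArrows.arrowEquiv).toIso) (fun _ ↦ rfl)

/-- A representable functor on a category with coproducts has copowers of the representing object as
left adjoint. -/
instance : catArrows.{u}.IsRightAdjoint :=
  have : (coyoneda.obj (op (ordinalCat.{u}.obj ⦋1⦌))).IsRightAdjoint :=
    (sigmaConstAdj _).isRightAdjoint
  Functor.isRightAdjoint_of_iso catArrowsIso

/-- The functors sending a category to its set of objects, respectively of arrows. -/
def catCells (b : Bool) : Cat.{u, u} ⥤ Type u :=
  match b with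
  | false => Cat.objects
  | true => catArrows

instance (b : Bool) : (catCells.{u} b).IsRightAdjoint := by
  cases b
  · exact Cat.typeToCatObjectsAdj.isRightAdjoint
  · exact inferInstanceAs catArrows.IsRightAdjoint

/-- The simplicial set of objects, respectively of arrows, of a simplicial category. -/
def simplicialCells (b : Bool) : SimplicialObject Cat.{u, u} ⥤ SSet.{u} :=
  (SimplicialObject.whiskering _ _).obj (catCells b)

instance (b : Bool) : (simplicialCells.{u} b).IsRightAdjoint :=
  ((Adjunction.ofIsRightAdjoint (catCells.{u} b)).whiskerRight SimplexCategoryᵒᵖ).isRightAdjoint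

/-- The Segal maps for the simplicial sets of objects and of arrows. -/
abbrev verticalSegalMaps : MorphismProperty (SimplicialObject Cat.{u, u}) :=
  MorphismProperty.ofHoms fun t : Bool × ℕ ↦
    (simplicialCells.{u} t.1).leftAdjoint.map (SSet.segalMap t.2)

lemma bijective_comp_map_iff {C D : Type*} [Category* C] [Category* D] {L : C ⥤ D} {R : D ⥤ C}
    (adj : L ⊣ R) {X Y : C} (f : X ⟶ Y) (Z : D) :
    Function.Bijective (fun g : L.obj Y ⟶ Z ↦ L.map f ≫ g) ↔
      Function.Bijective (fun g : Y ⟶ R.obj Z ↦ f ≫ g) := by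
  rw [← Function.Bijective.of_comp_iff' (adj.homEquiv X Z).bijective,
    ← Function.Bijective.of_comp_iff _ (adj.homEquiv Y Z).bijective]
  refine iff_of_eq (congrArg _ (funext fun g ↦ ?_))
  exact adj.homEquiv_naturality_left f g

/-- Locality for the left adjoint images of the Segal maps transposes to locality of the simplicial
sets of objects and of arrows. -/
lemma isLocal_verticalSegalMaps_iff (X : SimplicialObject Cat.{u, u}) :
    verticalSegalMaps.isLocal X ↔ ∀ b, ((simplicialCells b).obj X).IsSegal := by
  have h (b : Bool) (n : ℕ) := bijective_comp_map_iff
    (Adjunction.ofIsRightAdjoint (simplicialCells.{u} b)) (SSet.segalMap.{u} n) X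
  constructor
  · intro hX b
    rw [← SSet.isLocal_segalMaps_iff]
    rintro _ _ _ ⟨n⟩
    exact (h b n).1 (hX _ ⟨(b, n)⟩)
  · rintro hX _ _ _ ⟨b, n⟩
    exact (h b n).2 ((SSet.isLocal_segalMaps_iff _).2 (hX b) _ ⟨n⟩)

namespace SSet.SegalObj

variable {K : SSet.{u}} (hK : K.IsSegal)

/-- The simplices of a simplicial set satisfying the Segal condition as functors on ordinals. -/
def pointsEquiv (n : SimplexCategory) :
    (ordinalCat.{u}.obj n ⟶ Cat.of (SegalObj hK)) ≃ K.obj (op n) :=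
  (ordinalCatHomEquiv (Cat.of (SegalObj hK)) n).trans
    ((asIso (toNerve hK)).app (op n)).symm.toEquiv

lemma pointsEquiv_map {m n : SimplexCategory} (a : m ⟶ n)
    (z : ordinalCat.{u}.obj n ⟶ Cat.of (SegalObj hK)) :
    pointsEquiv hK m (ordinalCat.map a ≫ z) = K.map a.op (pointsEquiv hK n z) :=
  congrArg (fun φ ↦ φ (ordinalCatHomEquiv (Cat.of (SegalObj hK)) n z))
    ((asIso (toNerve hK)).inv.naturality a.op)

end SSet.SegalObj

/-- A simplicial category whose simplicial sets of objects and of arrows satisfy the Segal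
condition is presented by a double category. -/
def nervePresentationOfIsSegal (X : SimplicialObject Cat.{u, u})
    (hX : ∀ b, ((simplicialCells b).obj X).IsSegal) :
    InternalCategory.NervePresentation ordinalCat.{u} X where
  D₀ := Cat.of (SSet.SegalObj (hX false))
  D₁ := Cat.of (SSet.SegalObj (hX true))
  e₀ := SSet.SegalObj.pointsEquiv (hX false)
  e₁ := SSet.SegalObj.pointsEquiv (hX true)
  e₀_map := SSet.SegalObj.pointsEquiv_map (hX false)
  e₁_map := SSet.SegalObj.pointsEquiv_map (hX true)

/-- The simplicial set of objects of the vertical nerve. -/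
def verticalNerveObjIso (D : DblCat.{u}) :
    (simplicialCells false).obj (verticalNerve.obj D) ≅ nerve D.A₀ :=
  NatIso.ofComponents (fun n ↦ Equiv.toIso
    { toFun x := ordinalCatHomEquiv D.A₀ n.unop (InternalCategory.Points.pt x)
      invFun y := (⟨(ordinalCatHomEquiv D.A₀ n.unop).symm y⟩ : InternalCategory.Points D _)
      left_inv _ := rfl
      right_inv _ := rfl }) (fun _ ↦ rfl)

/-- The simplicial set of arrows of the vertical nerve. -/
def verticalNerveArrowIso (D : DblCat.{u}) :
    (simplicialCells true).obj (verticalNerve.obj D) ≅ nerve D.A₁ :=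
  NatIso.ofComponents (fun n ↦ Equiv.toIso
    { toFun (x : Arrow (InternalCategory.Points D (ordinalCat.obj n.unop))) :=
        ordinalCatHomEquiv D.A₁ n.unop x.hom.1
      invFun y := Arrow.mk (D.homMk ((ordinalCatHomEquiv D.A₁ n.unop).symm y))
      left_inv := by
        rintro ⟨⟨a⟩, ⟨b⟩, ⟨f, hs, ht⟩⟩
        change f ≫ D.s = a at hs
        change f ≫ D.t = b at ht
        subst hs ht
        rfl
      right_inv _ := rfl }) (fun _ ↦ rfl)

/-- The vertical nerve as a functor to local objects. -/
def verticalNerveSegal : DblCat.{u} ⥤ verticalSegalMaps.{u}.isLocal.FullSubcategory :=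
  verticalSegalMaps.isLocal.lift verticalNerve fun D ↦ (isLocal_verticalSegalMaps_iff _).2 (by
    rintro (_ | _)
    · exact (SSet.isSegal_nerve _).of_iso (verticalNerveObjIso D).symm
    · exact (SSet.isSegal_nerve _).of_iso (verticalNerveArrowIso D).symm)

instance : verticalNerve.{u}.Full :=
  inferInstanceAs (InternalCategory.pointsNerve ordinalCat.{u}).Full

instance : verticalNerve.{u}.Faithful :=
  inferInstanceAs (InternalCategory.pointsNerve ordinalCat.{u}).Faithful

instance : verticalNerveSegal.{u}.IsEquivalence where
  full := inferInstanceAs (verticalSegalMaps.isLocal.lift verticalNerve _).Full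
  faithful := inferInstanceAs (verticalSegalMaps.isLocal.lift verticalNerve _).Faithful
  essSurj := ⟨fun X ↦ by
    let P := nervePresentationOfIsSegal X.obj ((isLocal_verticalSegalMaps_iff _).1 X.2)
    exact ⟨P.internalCategory, ⟨verticalSegalMaps.isLocal.isoMk P.nerveIso⟩⟩⟩

/-- The vertical nerve is an equivalence onto a small orthogonality class of a locally presentable
category, followed by its inclusion, and such an inclusion has a reflection. -/
instance : verticalNerve.{u}.IsRightAdjoint := by
  obtain ⟨κ, _, h⟩ := exists_regular_ofHoms_isCardinalPresentable.{u}
    fun t : Bool × ℕ ↦ (simplicialCells.{u} t.1).leftAdjoint.map (SSet.segalMap t.2)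
  have : MorphismProperty.IsSmall.{u} verticalSegalMaps.{u} := MorphismProperty.isSmall_ofHoms _
  have : verticalSegalMaps.{u}.isLocal.ι.IsRightAdjoint :=
    MorphismProperty.isRightAdjoint_ι_isLocal verticalSegalMaps.{u} κ h
  exact inferInstanceAs (verticalNerveSegal.{u} ⋙ verticalSegalMaps.isLocal.ι).IsRightAdjoint

instance : Reflective verticalNerve.{u} where
  L := verticalNerve.leftAdjoint
  adj := Adjunction.ofIsRightAdjoint verticalNerve

instance : HasLimits DblCat.{u} := hasLimits_of_reflective verticalNerve.{u}

instance : HasColimits DblCat.{u} := hasColimits_of_reflective verticalNerve.{u}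

/-! ### The diagram categorical model structure -/

/-- The standard simplices as a functor. -/
abbrev stdSimplexFunctor : SimplexCategory ⥤ SSet.{u} := SSet.stdSimplex

instance : stdSimplexFunctor.{u}.IsPointDense where
  hom_ext {K L f g} h := by
    ext n x
    have := congrArg SSet.yonedaEquiv (h n.unop (SSet.yonedaEquiv.symm x))
    simp only [SSet.yonedaEquiv_symm_comp, Equiv.apply_symm_apply] at this
    exact this
  exists_hom {K L} φ hφ := by
    let α : K ⟶ L :=
      { app n := ↾fun x ↦ SSet.yonedaEquiv (φ n.unop (SSet.yonedaEquiv.symm x))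
        naturality m n a := by
          ext x
          have h₁ := hφ _ _ a.unop (SSet.yonedaEquiv.symm x)
          obtain ⟨y, hy⟩ := SSet.yonedaEquiv.symm.surjective (φ m.unop (SSet.yonedaEquiv.symm x))
          rw [SSet.stdSimplex_map_yonedaEquiv_symm, ← hy, SSet.stdSimplex_map_yonedaEquiv_symm] at h₁
          refine (congrArg SSet.yonedaEquiv h₁).trans ?_
          rw [Equiv.apply_symm_apply]
          refine (congrArg (L.map a) ?_)
          rw [Equiv.symm_apply_eq] at hy
          exact hy }
    refine ⟨α, fun n z ↦ ?_⟩
    obtain ⟨x, rfl⟩ := SSet.yonedaEquiv.symm.surjective z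
    rw [SSet.yonedaEquiv_symm_comp, Equiv.symm_apply_eq]
    rfl

/-- Every simplicial category is presented by an internal category in simplicial sets. -/
def nervePresentationStdSimplex (X : SimplicialObject Cat.{u, u}) :
    InternalCategory.NervePresentation stdSimplexFunctor.{u} X where
  D₀ := (simplicialCells false).obj X
  D₁ := (simplicialCells true).obj X
  e₀ n := SSet.yonedaEquiv
  e₁ n := SSet.yonedaEquiv
  e₀_map {m n} a z := by
    obtain ⟨x, rfl⟩ := SSet.yonedaEquiv.symm.surjective z
    refine (congrArg SSet.yonedaEquiv (SSet.stdSimplex_map_yonedaEquiv_symm a x)).trans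
      ((Equiv.apply_symm_apply _ _).trans ?_)
    exact congrArg (X.map a.op).toFunctor.obj (Equiv.apply_symm_apply SSet.yonedaEquiv x).symm
  e₁_map {m n} a z := by
    obtain ⟨x, rfl⟩ := SSet.yonedaEquiv.symm.surjective z
    refine (congrArg SSet.yonedaEquiv (SSet.stdSimplex_map_yonedaEquiv_symm a x)).trans
      ((Equiv.apply_symm_apply _ _).trans ?_)
    exact congrArg (X.map a.op).toFunctor.mapArrow.obj
      (Equiv.apply_symm_apply SSet.yonedaEquiv x).symm

/-- Simplicial categories are thus internal categories in `SSet`, so the factorizations built for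
internal categories apply to them as well. -/
instance : (InternalCategory.pointsNerve stdSimplexFunctor.{u}).IsEquivalence where
  essSurj := ⟨fun X ↦ ⟨_, ⟨(nervePresentationStdSimplex X).nerveIso⟩⟩⟩

/-! ### Transport of factorizations and lifting properties along an equivalence -/

section Transfer

variable {C D : Type*} [Category* C] [Category* D] (E : D ⥤ C) [E.IsEquivalence]

lemma inverseImage_inverseImage_inv (T : MorphismProperty C) [T.RespectsIso] :
    (T.inverseImage E).inverseImage E.inv = T := by
  ext X Y f
  exact T.arrow_mk_iso_iff (((Functor.mapArrowFunctor _ _).mapIso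
    E.asEquivalence.counitIso).app (Arrow.mk f))

lemma hasFactorization_of_inverseImage (T₁ T₂ : MorphismProperty C) [T₁.RespectsIso]
    [T₂.RespectsIso] [(T₁.inverseImage E).HasFactorization (T₂.inverseImage E)] :
    T₁.HasFactorization T₂ := by
  rw [← inverseImage_inverseImage_inv E T₁, ← inverseImage_inverseImage_inv E T₂]
  infer_instance

lemma inverseImage_llp (T : MorphismProperty C) [T.RespectsIso] :
    T.llp.inverseImage E = (T.inverseImage E).llp := by
  ext X Y f
  constructor
  · intro h A B q hq
    have := h _ hq
    exact (E.hasLiftingProperty_iff_of_isEquivalence _ _).1 this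
  · intro h A B q hq
    rw [← inverseImage_inverseImage_inv E T] at hq
    have := h _ hq
    exact (E.asEquivalence.toAdjunction.hasLiftingProperty_iff _ _).2 this

end Transfer

/-- The levelwise equivalences of simplicial categories. -/
abbrev levelwiseEquivalences : MorphismProperty (SimplicialObject Cat.{u, u}) :=
  catEquivalences.functorCategory SimplexCategoryᵒᵖ

/-- The levelwise isofibrations of simplicial categories. -/
abbrev levelwiseIsofibrations : MorphismProperty (SimplicialObject Cat.{u, u}) :=
  isofibrations.functorCategory SimplexCategoryᵒᵖ

instance : levelwiseEquivalences.{u}.HasFactorization levelwiseIsofibrations.{u} :=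
  have : (levelwiseEquivalences.{u}.inverseImage
      (InternalCategory.pointsNerve stdSimplexFunctor.{u})).HasFactorization
      (levelwiseIsofibrations.{u}.inverseImage
        (InternalCategory.pointsNerve stdSimplexFunctor.{u})) :=
    inferInstanceAs ((InternalCategory.nerveEquivalences stdSimplexFunctor.{u}).HasFactorization
      (InternalCategory.nerveFibrations stdSimplexFunctor.{u}))
  hasFactorization_of_inverseImage (InternalCategory.pointsNerve stdSimplexFunctor.{u}) _ _

instance : (levelwiseIsofibrations.{u} ⊓ levelwiseEquivalences.{u}).llp.HasFactorization
    (levelwiseIsofibrations.{u} ⊓ levelwiseEquivalences.{u}) :=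
  have : ((levelwiseIsofibrations.{u} ⊓ levelwiseEquivalences.{u}).llp.inverseImage
      (InternalCategory.pointsNerve stdSimplexFunctor.{u})).HasFactorization
      ((levelwiseIsofibrations.{u} ⊓ levelwiseEquivalences.{u}).inverseImage
        (InternalCategory.pointsNerve stdSimplexFunctor.{u})) := by
    rw [inverseImage_llp]
    exact inferInstanceAs ((InternalCategory.nerveFibrations stdSimplexFunctor.{u} ⊓
      InternalCategory.nerveEquivalences stdSimplexFunctor.{u}).llp.HasFactorization
      (InternalCategory.nerveFibrations stdSimplexFunctor.{u} ⊓
      InternalCategory.nerveEquivalences stdSimplexFunctor.{u}))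
  hasFactorization_of_inverseImage (InternalCategory.pointsNerve stdSimplexFunctor.{u}) _ _

/-- The diagram categorical model structure on simplicial categories. -/
abbrev diagramCategoricalModelCategory : ModelCategory (SimplicialObject Cat.{u, u}) :=
  modelCategoryOfFactorizations levelwiseEquivalences.{u} levelwiseIsofibrations.{u}

/-! ### The model structure on double categories -/

/-- The model structure on double categories induced by the simplicially surjective topology. -/
abbrev dblCatModelCategory : ModelCategory DblCat.{u} :=
  have : (InternalCategory.nerveEquivalences ordinalCat.{u}).IsStableUnderRetracts :=
    inferInstanceAs ((catEquivalences.functorCategory _).inverseImage _).IsStableUnderRetracts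
  have : (InternalCategory.nerveFibrations ordinalCat.{u}).IsStableUnderRetracts :=
    inferInstanceAs ((isofibrations.functorCategory _).inverseImage _).IsStableUnderRetracts
  have : (InternalCategory.nerveFibrations ordinalCat.{u}).IsStableUnderComposition :=
    inferInstanceAs ((isofibrations.functorCategory _).inverseImage _).IsStableUnderComposition
  -- The vertical nerve is a right adjoint, so it carries pullback squares to pullback squares.
  have : (InternalCategory.nerveFibrations ordinalCat.{u}).IsStableUnderBaseChange :=
    ⟨fun sq h ↦ (isofibrations.functorCategory SimplexCategoryᵒᵖ).of_isPullback
      (sq.map verticalNerve.{u}) h⟩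
  modelCategoryOfFactorizations (InternalCategory.nerveEquivalences ordinalCat.{u})
    (InternalCategory.nerveFibrations ordinalCat.{u})

/-- Lifting problems transpose across the adjunction. Since `I.map L` is closed under isomorphism of
arrows, the second direction passes through such an isomorphism. -/
lemma rlp_map_iff_of_adjunction {C D : Type*} [Category* C] [Category* D] {L : C ⥤ D} {R : D ⥤ C}
    (adj : L ⊣ R) (I : MorphismProperty C) {X Y : D} (f : X ⟶ Y) :
    (I.map L).rlp f ↔ I.rlp (R.map f) := by
  constructor
  · intro h A B i hi
    have := h _ (I.map_mem_map L i hi)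
    exact (adj.hasLiftingProperty_iff i f).1 this
  · rintro h A B i ⟨A', B', i', hi', ⟨e⟩⟩
    have := (adj.hasLiftingProperty_iff i' f).2 (h i' hi')
    exact HasLiftingProperty.of_arrow_iso_left e f

theorem mainTheorem5 :
    ∃ (c_v : SimplicialObject Cat.{u, u} ⥤ DblCat.{u}) (adj : c_v ⊣ verticalNerve.{u})
      (M_diag : ModelCategory (SimplicialObject Cat.{u, u}))
      (M_τ M_tr : ModelCategory DblCat.{u}),
      IsDiagramCategorical M_diag ∧
      InternalCategory.IsInducedByTopology simpliciallySurjectiveTopology.{u} M_τ ∧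
      IsTransferred adj M_diag M_tr ∧
      M_τ = M_tr ∧
      (∀ {A B : DblCat.{u}} (F : A ⟶ B),
        InternalCategory.topologyEquivalences simpliciallySurjectiveTopology.{u} F ↔
          ∀ n, ((verticalNerve.map F).app n).toFunctor.IsEquivalence) ∧
      (∀ {A B : DblCat.{u}} (F : A ⟶ B),
        InternalCategory.topologyFibrations simpliciallySurjectiveTopology.{u} F ↔
          ∀ n, IsIsofibration ((verticalNerve.map F).app n).toFunctor) := by
  -- One structure serves both as the induced and as the transferred one: its classes are inverse
  -- images under the vertical nerve, so the transfer conditions on them hold by definition, and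
  -- only the comparison with `τ` needs an argument.
  refine ⟨verticalNerve.leftAdjoint, Adjunction.ofIsRightAdjoint verticalNerve,
    diagramCategoricalModelCategory, dblCatModelCategory, dblCatModelCategory,
    ⟨fun _ ↦ Iff.rfl, fun _ ↦ Iff.rfl⟩,
    ⟨topologyEquivalences_eq.symm, topologyFibrations_eq.symm, ?_⟩,
    ⟨fun _ ↦ Iff.rfl, fun _ ↦ Iff.rfl, fun I hI ↦ ?_, fun J hJ ↦ ?_⟩, rfl, fun F ↦ ?_, fun F ↦ ?_⟩
  · rw [InternalCategory.topologyCofibrations, topologyEquivalences_eq, topologyFibrations_eq]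
    rfl
  · ext X Y f
    rw [rlp_map_iff_of_adjunction (Adjunction.ofIsRightAdjoint verticalNerve), hI]
    rfl
  · ext X Y f
    rw [rlp_map_iff_of_adjunction (Adjunction.ofIsRightAdjoint verticalNerve), hJ]
    rfl
  · rw [topologyEquivalences_eq]
    rfl
  · rw [topologyFibrations_eq]
    rfl

end
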